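/- Consider the defocusing cubic NLS equation on the half-line, $$i q_t + q_{xx} - 2|q|^2 q = 0,\qquad x>0,\ t>0,$$ with initial and Dirichlet data $q(x,0)=q_0(x)$ for $x\ge 0$ and $q(0,t)=Q(t)$ for $t\ge 0$. Let $Q\in C^2([0,\infty);\mathbb{C})$ with $Q(0)=q_0(0)$, and let $q$ be the global solution of this problem in the class $$q\in C^1\big([0,\infty);L^2(0,\infty)\big)\cap C^0\big([0,\infty);H^2(0,\infty)\big)$$ (so that $q_0=q(\cdot,0)\in H^2(0,\infty)$; the equation holds in $L^2(0,\infty)$ for every $t>0$, and for each $t\ge 0$, $q(\cdot,t)$ denotes the representative that is continuous on $[0,\infty)$). Assume that $x\,q_0\in L^2(0,\infty)$ and that, as $t\to\infty$, $$q(0,t)=\mathcal{O}(t^{-\alpha}),\qquad q_t(0,t)=\mathcal{O}(t^{-\beta})\qquad\text{for some } \alpha>\tfrac32,\ \beta>\tfrac52.$$ Then $$\lim_{t\to\infty} q(x,t)=0\qquad\text{for every } x>0,$$ and the convergence is uniform in $x\in(0,\infty)$. -/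

import Mathlib

open Set Filter Topology MeasureTheory Asymptotics
open scoped ContDiff

/-- Lebesgue measure on the half-line `(0, ∞)`. -/
noncomputable abbrev halfLine : Measure ℝ := volume.restrict (Ioi 0)

/-- The complex Hilbert space `L²(0, ∞)`. -/
abbrev HalfLineL2 : Type := Lp ℂ 2 halfLine

/-- `g ∈ L²(0, ∞)` is the weak derivative of `f ∈ L²(0, ∞)` on the open half-line, tested against
smooth functions with compact support in `(0, ∞)`. -/
def IsWeakDeriv (f g : HalfLineL2) : Prop :=
  ∀ φ : ℝ → ℝ, ContDiff ℝ ∞ φ → HasCompactSupport φ → tsupport φ ⊆ Ioi 0 →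
    ∫ x, deriv φ x • f x ∂halfLine = -∫ x, φ x • g x ∂halfLine

/-- The Sobolev space `H²(0, ∞)`: a function is stored together with its first and second weak
derivatives, as the triple `(f, f', f'')`. The topology induced from `L² × L² × L²` is the one of
the usual norm `(‖f‖² + ‖f'‖² + ‖f''‖²)^(1/2)`. -/
abbrev HalfLineH2 : Type :=
  {p : HalfLineL2 × HalfLineL2 × HalfLineL2 // IsWeakDeriv p.1 p.2.1 ∧ IsWeakDeriv p.2.1 p.2.2}

namespace HalfLineH2

/-- The underlying `L²` function of an element of `H²(0, ∞)`. -/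
def toL2 (p : HalfLineH2) : HalfLineL2 := p.1.1

/-- The second weak derivative of an element of `H²(0, ∞)`. -/
def deriv2 (p : HalfLineH2) : HalfLineL2 := p.1.2.2

end HalfLineH2

/-- The function `q(x, t)` (of which only the values for `x ≥ 0`, `t ≥ 0` matter) is described by
the curve `u` in `H²(0, ∞)`, which lies in `C⁰([0, ∞); H²) ∩ C¹([0, ∞); L²)`, and solves
`i q_t + q_xx - 2 |q|² q = 0` for `x > 0`, `t > 0`, with `q(x, 0) = q₀(x)`, `q(0, t) = Q(t)`. -/
structure IsNLSCurve (q₀ Q : ℝ → ℂ) (q : ℝ → ℝ → ℂ) (u : ℝ → HalfLineH2) : Prop where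
  /-- `u ∈ C⁰([0, ∞); H²)`. -/
  continuous_H2 : ContinuousOn u (Ici 0)
  /-- `u ∈ C¹([0, ∞); L²)`. -/
  contDiff_L2 : ContDiffOn ℝ 1 (fun t => (u t).toL2) (Ici 0)
  /-- `q(·, t)` is a representative of `u t`. -/
  represents : ∀ t, 0 ≤ t → (fun x => q x t) =ᵐ[halfLine] (u t).toL2
  /-- `q(·, t)` is the continuous representative, up to the boundary point `x = 0`. -/
  continuous_space : ∀ t, 0 ≤ t → ContinuousOn (fun x => q x t) (Ici 0)
  /-- The equation, as an identity in `L²(0, ∞)` for each `t > 0`. -/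
  equation : ∀ t, 0 < t → ∀ᵐ x ∂halfLine,
    Complex.I * derivWithin (fun s => (u s).toL2) (Ici 0) t x + (u t).deriv2 x
      - 2 * (‖q x t‖ : ℂ) ^ 2 * q x t = 0
  /-- The initial condition. -/
  initial : ∀ x, 0 ≤ x → q x 0 = q₀ x
  /-- The Dirichlet boundary condition. -/
  boundary : ∀ t, 0 ≤ t → q 0 t = Q t

/-- `q` is a global solution in the class `C¹([0, ∞); L²) ∩ C⁰([0, ∞); H²)` of the defocusing cubic
NLS equation on the half-line with initial data `q₀` and Dirichlet data `Q`. -/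
def IsGlobalNLSSolution (q₀ Q : ℝ → ℂ) (q : ℝ → ℝ → ℂ) : Prop :=
  ∃ u : ℝ → HalfLineH2, IsNLSCurve q₀ Q q u

/-! The decay comes from a pseudo-conformal estimate adapted to the half-line. Write `p = q_x`, `b =
∂_t q(0,t)`, `s = 1 + t`.

Three balance laws hold. The mass `∫|q|²` has derivative `2 Im(q̄ p)(0)`, the energy `∫(|p|² +
|q|⁴)` has derivative `-2 Re(p̄ b)(0)`, and the momentum `∫ Im(q̄ p)` has derivative `|p(0)|² -
|q(0)|⁴ - Im(q̄ b)(0)`. The unknown flux `∫|p(0,t)|² dt` is thus controlled by the momentum, which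
is at most half the sum of mass and energy; these in turn grow by at most half the flux each, so the
flux absorbs itself and all three stay bounded (`exists_bound`).

The functional `W = ∫|x q + 2is p|² + 4s² ∫|q|⁴` has bulk derivative `4s ∫|q|⁴ ≤ W/s`. Hence `W/s`
grows only through the boundary terms `-4 Re(q̄ p) - 8s Re(p̄ b)` at `x = 0`, which are integrable
in time by the flux bound and the decay of the data. So `W = O(s)`. Since `Im(q̄ (x q + 2is p)) = 2s
Re(q̄ p) = s ∂_x|q|²`, integrating from infinity and using Cauchy–Schwarz gives `|q|² ≤ s⁻¹ ‖q‖ √W =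
O(s^(-1/2))`, uniformly in `x` (`norm_q_sq_le_pseudoconformal`, `exists_norm_sq_le`).

Two technical points shape the proof. The weight `x` is unbounded, so it is replaced by `R
arctan(x/R)`, and the error is removed by letting `R → ∞` at a fixed final time. And `q_x` is not
differentiable in time, so the balance laws are derived from exact difference identities
(`hasDerivWithinAt_of_sub_eq_inner`). -/

open scoped ComplexConjugate

/-! ### Calculus of absolutely continuous functions on the half-line -/

/-- `F` is, on `[0, ∞)`, a primitive of the locally integrable function `f`. -/
structure IsPrimitive (F f : ℝ → ℂ) : Prop where
  intervalIntegrable : ∀ b, 0 ≤ b → IntervalIntegrable f volume 0 b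
  eq_add_integral : ∀ x, 0 ≤ x → F x = F 0 + ∫ y in (0 : ℝ)..x, f y

theorem IntervalIntegrable.absolutelyContinuousOnInterval_integral_complex {f : ℝ → ℂ} {a b : ℝ}
    (hf : IntervalIntegrable f volume a b) :
    AbsolutelyContinuousOnInterval (fun x => ∫ y in a..x, f y) a b := by
  have hre : IntervalIntegrable (fun x => (f x).re) volume a b := ⟨hf.1.re, hf.2.re⟩
  have him : IntervalIntegrable (fun x => (f x).im) volume a b := ⟨hf.1.im, hf.2.im⟩
  have hc : ∀ c : ℂ, AbsolutelyContinuousOnInterval (fun _ : ℝ => c) a b := fun c =>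
    (contDiffOn_const (n := 1)).absolutelyContinuousOnInterval
  have h := ((hre.absolutelyContinuousOnInterval_intervalIntegral (c := a) (by simp)).smul
    (hc 1)).add ((him.absolutelyContinuousOnInterval_intervalIntegral (c := a) (by simp)).smul
    (hc Complex.I))
  have key : ∀ x ∈ uIcc a b, (∫ y in a..x, f y) =
      (((fun x => ∫ y in a..x, (f y).re) • fun _ : ℝ => (1 : ℂ)) +
      ((fun x => ∫ y in a..x, (f y).im) • fun _ : ℝ => Complex.I)) x := by
    intro x hx
    have hfx : IntervalIntegrable f volume a x := hf.mono_set (uIcc_subset_uIcc_left hx)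
    have e1 : (∫ y in a..x, f y).re = ∫ y in a..x, (f y).re :=
      (Complex.reCLM.intervalIntegral_comp_comm hfx).symm
    have e2 : (∫ y in a..x, f y).im = ∫ y in a..x, (f y).im :=
      (Complex.imCLM.intervalIntegral_comp_comm hfx).symm
    simp only [Pi.add_apply, Pi.smul_apply']
    rw [← e1, ← e2]
    apply Complex.ext <;> simp
  -- Absolute continuity only samples points of the interval, where `key` identifies the two
  -- functions.
  rw [absolutelyContinuousOnInterval_iff] at h ⊢
  intro ε hε
  obtain ⟨δ, hδ, H⟩ := h ε hε
  refine ⟨δ, hδ, fun E hE hlt => ?_⟩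
  refine lt_of_eq_of_lt (Finset.sum_congr rfl fun i hi => ?_) (H E hE hlt)
  rw [key _ (hE.1 i hi).1, key _ (hE.1 i hi).2]

namespace IsPrimitive

variable {F G f g : ℝ → ℂ}

theorem continuousOn (h : IsPrimitive F f) : ContinuousOn F (Ici 0) := by
  have key : ∀ b, 0 ≤ b → ContinuousOn F (Icc 0 b) := by
    intro b hb
    have h1 : ContinuousOn (fun x => F 0 + ∫ y in (0 : ℝ)..x, f y) (Icc 0 b) := by
      have := (h.intervalIntegrable b hb).absolutelyContinuousOnInterval_integral_complex.continuousOn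
      rw [uIcc_of_le hb] at this
      exact continuousOn_const.add this
    exact h1.congr fun x hx => h.eq_add_integral x hx.1
  intro x hx
  have h2 := key (x + 1) (by have := mem_Ici.1 hx; linarith) x ⟨hx, by linarith⟩
  refine h2.mono_of_mem_nhdsWithin ?_
  rw [mem_nhdsWithin]
  exact ⟨Iio (x + 1), isOpen_Iio, by simp, fun y hy => ⟨hy.2, le_of_lt hy.1⟩⟩

theorem congr_right (h : IsPrimitive F f) (hfg : f =ᵐ[halfLine] g) : IsPrimitive F g := by
  have h2 : ∀ᵐ x, x ∈ Ioi (0 : ℝ) → f x = g x := (ae_restrict_iff' measurableSet_Ioi).1 hfg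
  refine ⟨fun b hb => (h.intervalIntegrable b hb).congr_ae ?_, fun x hx => ?_⟩
  · rw [uIoc_of_le hb]
    exact (ae_restrict_iff' measurableSet_Ioc).2 (h2.mono fun x hx hx' => hx hx'.1)
  · rw [h.eq_add_integral x hx]
    congr 1
    refine intervalIntegral.integral_congr_ae (h2.mono fun y hy hy' => ?_)
    rw [uIoc_of_le hx] at hy'
    exact hy hy'.1

theorem congr_left (h : IsPrimitive F f) (hFG : ∀ x, 0 ≤ x → F x = G x) : IsPrimitive G f :=
  ⟨h.intervalIntegrable, fun x hx => by rw [← hFG x hx, ← hFG 0 le_rfl, h.eq_add_integral x hx]⟩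

theorem add (hF : IsPrimitive F f) (hG : IsPrimitive G g) :
    IsPrimitive (fun x => F x + G x) (fun x => f x + g x) := by
  refine ⟨fun b hb => (hF.intervalIntegrable b hb).add (hG.intervalIntegrable b hb),
    fun x hx => ?_⟩
  rw [intervalIntegral.integral_add (hF.intervalIntegrable x hx) (hG.intervalIntegrable x hx),
    hF.eq_add_integral x hx, hG.eq_add_integral x hx]
  ring

theorem const_mul (c : ℂ) (hF : IsPrimitive F f) :
    IsPrimitive (fun x => c * F x) (fun x => c * f x) := by
  refine ⟨fun b hb => (hF.intervalIntegrable b hb).const_mul c, fun x hx => ?_⟩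
  rw [intervalIntegral.integral_const_mul, hF.eq_add_integral x hx]
  ring

theorem sub (hF : IsPrimitive F f) (hG : IsPrimitive G g) :
    IsPrimitive (fun x => F x - G x) (fun x => f x - g x) := by
  simpa [sub_eq_add_neg] using hF.add (hG.const_mul (-1))

theorem star (hF : IsPrimitive F f) :
    IsPrimitive (fun x => (starRingEnd ℂ) (F x)) (fun x => (starRingEnd ℂ) (f x)) := by
  refine ⟨fun b hb => ?_, fun x hx => ?_⟩
  · have h := hF.intervalIntegrable b hb
    exact ⟨Complex.conjCLE.toContinuousLinearMap.integrable_comp h.1,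
      Complex.conjCLE.toContinuousLinearMap.integrable_comp h.2⟩
  · have h := Complex.conjCLE.toContinuousLinearMap.intervalIntegral_comp_comm
      (hF.intervalIntegrable x hx)
    have h' : ∫ y in (0 : ℝ)..x, (starRingEnd ℂ) (f y) = (starRingEnd ℂ) (∫ y in (0 : ℝ)..x, f y) := h
    rw [hF.eq_add_integral x hx, map_add, h']

/-- By Lebesgue differentiation, the product minus the integral of its formal derivative is
absolutely continuous with derivative zero almost everywhere, hence constant. -/
theorem mul (hF : IsPrimitive F f) (hG : IsPrimitive G g) :
    IsPrimitive (fun x => F x * G x) (fun x => f x * G x + F x * g x) := by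
  have hint : ∀ b, 0 ≤ b → IntervalIntegrable (fun x => f x * G x + F x * g x) volume 0 b := by
    intro b hb
    have hs : uIcc 0 b ⊆ Ici 0 := by rw [uIcc_of_le hb]; exact Icc_subset_Ici_self
    exact ((hF.intervalIntegrable b hb).mul_continuousOn (hG.continuousOn.mono hs)).add
      ((hG.intervalIntegrable b hb).continuousOn_mul (hF.continuousOn.mono hs))
  refine ⟨hint, fun b hb => ?_⟩
  set F' : ℝ → ℂ := fun x => F 0 + ∫ y in (0 : ℝ)..x, f y with hF'
  set G' : ℝ → ℂ := fun x => G 0 + ∫ y in (0 : ℝ)..x, g y with hG'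
  have eF : ∀ x ∈ uIcc 0 b, F x = F' x := fun x hx => hF.eq_add_integral x
    (by rw [uIcc_of_le hb] at hx; exact hx.1)
  have eG : ∀ x ∈ uIcc 0 b, G x = G' x := fun x hx => hG.eq_add_integral x
    (by rw [uIcc_of_le hb] at hx; exact hx.1)
  have hc : ∀ c : ℂ, AbsolutelyContinuousOnInterval (fun _ : ℝ => c) 0 b := fun c =>
    (contDiffOn_const (n := 1)).absolutelyContinuousOnInterval
  have aF : AbsolutelyContinuousOnInterval F' 0 b :=
    (hc (F 0)).add (hF.intervalIntegrable b hb).absolutelyContinuousOnInterval_integral_complex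
  have aG : AbsolutelyContinuousOnInterval G' 0 b :=
    (hc (G 0)).add (hG.intervalIntegrable b hb).absolutelyContinuousOnInterval_integral_complex
  have aH := (aF.smul aG).sub (hint b hb).absolutelyContinuousOnInterval_integral_complex
  have hz : ∀ᵐ x, x ∈ uIcc 0 b →
      HasDerivAt (F' • G' - fun x => ∫ y in (0 : ℝ)..x, (f y * G y + F y * g y)) 0 x := by
    filter_upwards [(hF.intervalIntegrable b hb).ae_hasDerivAt_integral,
      (hG.intervalIntegrable b hb).ae_hasDerivAt_integral,
      (hint b hb).ae_hasDerivAt_integral] with x h1 h2 h3 hx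
    have d1 := (h1 hx 0 (by simp)).const_add (F 0)
    have d2 := (h2 hx 0 (by simp)).const_add (G 0)
    have d3 := (d1.mul d2).sub (h3 hx 0 (by simp))
    convert! d3 using 1
    rw [eF x hx, eG x hx]
    simp [hF', hG']
  obtain ⟨C, hC⟩ := aH.const_of_ae_hasDerivAt_zero hz
  have h0 := hC 0 (by simp)
  have h1 := hC b (by simp)
  simp only [Pi.sub_apply, Pi.mul_apply, smul_eq_mul, intervalIntegral.integral_same] at h0 h1
  rw [← eF 0 (by simp), ← eG 0 (by simp)] at h0
  rw [← eF b (by simp), ← eG b (by simp), ← h0] at h1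
  linear_combination h1

theorem of_hasDerivAt {w w' : ℝ → ℝ} (h : ∀ x, HasDerivAt w (w' x) x) (hc : Continuous w') :
    IsPrimitive (fun x => (w x : ℂ)) (fun x => (w' x : ℂ)) := by
  have hc' : Continuous fun x => (w' x : ℂ) := Complex.continuous_ofReal.comp hc
  refine ⟨fun b _ => hc'.intervalIntegrable _ _, fun x _ => ?_⟩
  rw [intervalIntegral.integral_eq_sub_of_hasDerivAt (fun y _ => (h y).ofReal_comp)
    (hc'.intervalIntegrable _ _)]
  ring

/-- Integrability of `f` gives `F` a limit at infinity; a nonzero limit would keep `‖F‖` bounded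
below on a half-line of infinite measure, contradicting integrability of `F`. -/
theorem integral_Ioi_eq (h : IsPrimitive F f) (hf : Integrable f halfLine)
    (hF : Integrable F halfLine) : ∫ x, f x ∂halfLine = -F 0 := by
  have h1 : Tendsto (fun x => F 0 + ∫ y in (0 : ℝ)..x, f y) atTop
      (𝓝 (F 0 + ∫ y in Ioi (0 : ℝ), f y)) :=
    tendsto_const_nhds.add (intervalIntegral_tendsto_integral_Ioi 0 hf tendsto_id)
  have h2 : Tendsto F atTop (𝓝 (F 0 + ∫ y in Ioi (0 : ℝ), f y)) :=
    h1.congr' ((eventually_ge_atTop 0).mono fun x hx => (h.eq_add_integral x hx).symm)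
  have h3 : F 0 + ∫ y in Ioi (0 : ℝ), f y = 0 := by
    by_contra hne
    have hev : ∀ᶠ x in atTop, ‖F 0 + ∫ y in Ioi (0 : ℝ), f y‖ / 2 ≤ ‖F x‖ :=
      (h2.norm.eventually (lt_mem_nhds (half_lt_self (norm_pos_iff.2 hne)))).mono
        fun x hx => le_of_lt hx
    obtain ⟨N, hN⟩ := eventually_atTop.1 hev
    have hpos : 0 < ‖F 0 + ∫ y in Ioi (0 : ℝ), f y‖ / 2 := half_pos (norm_pos_iff.2 hne)
    have hi : IntegrableOn (fun _ : ℝ => ‖F 0 + ∫ y in Ioi (0 : ℝ), f y‖ / 2)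
        (Ioi (max N 0)) := by
      have hF' : IntegrableOn F (Ioi (max N 0)) :=
        IntegrableOn.mono_set (t := Ioi 0) hF (Ioi_subset_Ioi (le_max_right _ _))
      refine Integrable.mono hF' aestronglyMeasurable_const ?_
      refine (ae_restrict_iff' measurableSet_Ioi).2 (Eventually.of_forall fun x hx => ?_)
      rw [Real.norm_of_nonneg hpos.le]
      exact hN x (le_trans (le_max_left _ _) (le_of_lt hx))
    rw [integrableOn_const_iff (by simp)] at hi
    simp at hi
    exact hne hi
  exact eq_neg_of_add_eq_zero_right h3

end IsPrimitive

/-! ### Weak derivatives and absolutely continuous representatives -/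

theorem MeasureTheory.MemLp.intervalIntegrable_halfLine {f : ℝ → ℂ} (hf : MemLp f 2 halfLine)
    {b : ℝ} (hb : 0 ≤ b) : IntervalIntegrable f volume 0 b := by
  rw [intervalIntegrable_iff_integrableOn_Ioc_of_le hb]
  have h : MemLp f 2 (volume.restrict (Ioc 0 b)) :=
    hf.mono_measure (Measure.restrict_mono Ioc_subset_Ioi_self le_rfl)
  exact h.integrable (by norm_num)

theorem MeasureTheory.MemLp.isPrimitive_integral {f : ℝ → ℂ} (hf : MemLp f 2 halfLine) (c : ℂ) :
    IsPrimitive (fun x => c + ∫ y in (0 : ℝ)..x, f y) f :=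
  ⟨fun _ hb => hf.intervalIntegrable_halfLine hb, fun x _ => by simp⟩

/-- A smooth function with mean zero and compact support in `(0, ∞)` is the derivative of a
smooth function with compact support in `(0, ∞)`. -/
theorem exists_primitive_of_integral_eq_zero {η : ℝ → ℝ} (hη : ContDiff ℝ ∞ η) {K : Set ℝ}
    (hK : IsCompact K) (hne : K.Nonempty) (hK0 : K ⊆ Ioi 0) (hs : Function.support η ⊆ K)
    (hint : ∫ x, η x = 0) :
    ∃ φ : ℝ → ℝ, ContDiff ℝ ∞ φ ∧ HasCompactSupport φ ∧ tsupport φ ⊆ Ioi 0 ∧ deriv φ = η := by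
  obtain ⟨a, haK, ha⟩ := hK.exists_isLeast hne
  obtain ⟨b, hbK, hb⟩ := hK.exists_isGreatest hne
  have ha0 : 0 < a := hK0 haK
  have hd : ∀ x, HasDerivAt (fun x => ∫ y in (0 : ℝ)..x, η y) (η x) x := fun x =>
    hη.continuous.integral_hasStrictDerivAt 0 x |>.hasDerivAt
  have hderiv : deriv (fun x => ∫ y in (0 : ℝ)..x, η y) = η := funext fun x => (hd x).deriv
  have hz : ∀ x, x ∉ Icc a b → ∫ y in (0 : ℝ)..x, η y = 0 := by
    intro x hx
    have hcase : x < a ∨ b < x := by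
      by_contra hcon
      rw [not_or, not_lt, not_lt] at hcon
      exact hx hcon
    -- Left of the support the integrand vanishes; right of it the integral is already the total
    -- one, which is zero.
    rcases hcase with h | h
    · refine intervalIntegral.integral_zero_ae (Eventually.of_forall fun y hy => ?_)
      by_contra hne0
      have hy1 := ha (hs hne0)
      have hy2 : y ≤ max 0 x := (mem_uIoc.1 hy).elim (fun h => h.2.trans (le_max_right _ _))
        (fun h => h.2.trans (le_max_left _ _))
      exact absurd (hy1.trans hy2) (not_le.2 (max_lt ha0 h))
    · rw [intervalIntegral.integral_eq_integral_of_support_subset, hint]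
      exact fun y hy => ⟨hK0 (hs hy), (hb (hs hy)).trans h.le⟩
  have hsub : tsupport (fun x => ∫ y in (0 : ℝ)..x, η y) ⊆ Icc a b :=
    closure_minimal (fun x hx => by
      by_contra hcon
      exact hx (hz x hcon)) isClosed_Icc
  refine ⟨fun x => ∫ y in (0 : ℝ)..x, η y, ?_, ?_, ?_, hderiv⟩
  · rw [contDiff_infty_iff_deriv, hderiv]
    exact ⟨fun x => (hd x).differentiableAt, hη⟩
  · exact HasCompactSupport.intro isCompact_Icc hz
  · exact hsub.trans fun x hx => lt_of_lt_of_le ha0 hx.1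

/-- A locally integrable function on `(0, ∞)` whose weak derivative vanishes is constant. -/
theorem ae_eq_const_of_integral_deriv_smul_eq_zero {h : ℝ → ℂ}
    (hh : ∀ b, 0 ≤ b → IntervalIntegrable h volume 0 b)
    (h0 : ∀ φ : ℝ → ℝ, ContDiff ℝ ∞ φ → HasCompactSupport φ → tsupport φ ⊆ Ioi 0 →
      ∫ x, deriv φ x • h x ∂halfLine = 0) :
    ∃ c : ℂ, h =ᵐ[halfLine] fun _ => c := by
  have hloc : ∀ c : ℂ, LocallyIntegrableOn (fun x => h x - c) (Ioi 0) volume := by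
    intro c
    rw [locallyIntegrableOn_iff isOpen_Ioi.isLocallyClosed]
    intro k hk hkc
    obtain ⟨b, hb⟩ := hkc.bddAbove
    have h1 := (hh (max b 0) (le_max_right _ _)).sub (intervalIntegrable_const (c := c))
    rw [intervalIntegrable_iff_integrableOn_Ioc_of_le (le_max_right _ _)] at h1
    exact h1.mono_set fun x hx => ⟨hk hx, (hb hx).trans (le_max_left _ _)⟩
  have hint : ∀ (ψ : ℝ → ℝ) (c : ℂ), ContDiff ℝ ∞ ψ → HasCompactSupport ψ → tsupport ψ ⊆ Ioi 0 →
      Integrable (fun x => ψ x • (h x - c)) halfLine := by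
    intro ψ c h1 h2 h3
    have hK : IntegrableOn (fun x => h x - c) (tsupport ψ) volume :=
      ((locallyIntegrableOn_iff isOpen_Ioi.isLocallyClosed).1 (hloc c)) _ h3 h2.isCompact
    have hK' : IntegrableOn (fun x => ψ x • (h x - c)) (tsupport ψ) volume :=
      hK.continuousOn_smul h1.continuous.continuousOn h2.isCompact
    exact ((integrableOn_iff_integrable_of_support_subset
      ((Function.support_smul_subset_left _ _).trans (subset_tsupport _))).1 hK').restrict
  -- A fixed bump of mass one, supported in `[1, 3]`. Subtracting `(∫ ψ) ψ₀` from a test function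
  -- `ψ` leaves mean zero, hence a derivative of a test function; the constant is therefore `∫ ψ₀
  -- h`.
  let B : ContDiffBump (2 : ℝ) := ⟨1 / 2, 1, by norm_num, by norm_num⟩
  set ψ₀ : ℝ → ℝ := B.normed volume with hψ₀
  have hB1 : ContDiff ℝ ∞ ψ₀ := B.contDiff_normed
  have hB2 : HasCompactSupport ψ₀ := B.hasCompactSupport_normed
  have hB3 : tsupport ψ₀ = Metric.closedBall 2 1 := B.tsupport_normed_eq
  have hB3' : tsupport ψ₀ ⊆ Ioi 0 := by
    rw [hB3, Real.closedBall_eq_Icc]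
    intro x hx
    have := hx.1
    norm_num at this
    exact lt_of_lt_of_le one_pos this
  have hB4 : ∫ x, ψ₀ x = 1 := B.integral_normed
  have hset : ∀ (ψ : ℝ → ℝ), tsupport ψ ⊆ Ioi 0 → ∫ x, ψ x ∂halfLine = ∫ x, ψ x := by
    intro ψ hψ
    exact setIntegral_eq_integral_of_forall_compl_eq_zero fun x hx => by
      by_contra hne
      exact hx (hψ (subset_tsupport _ hne))
  refine ⟨∫ x, ψ₀ x • h x ∂halfLine, ?_⟩
  set c : ℂ := ∫ x, ψ₀ x • h x ∂halfLine with hc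
  have key := isOpen_Ioi.ae_eq_zero_of_integral_contDiff_smul_eq_zero (hloc c) (fun ψ h1 h2 h3 => by
    have e1 : ∫ x, ψ x • (h x - c) = ∫ x, ψ x • (h x - c) ∂halfLine :=
      (setIntegral_eq_integral_of_forall_compl_eq_zero fun x hx => by
        have : ψ x = 0 := by
          by_contra hne
          exact hx (h3 (subset_tsupport _ hne))
        simp [this]).symm
    set I : ℝ := ∫ x, ψ x with hI
    have iψ : Integrable ψ volume := h1.continuous.integrable_of_hasCompactSupport h2
    have iψ₀ : Integrable ψ₀ volume := hB1.continuous.integrable_of_hasCompactSupport hB2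
    obtain ⟨φ, p1, p2, p3, p4⟩ := exists_primitive_of_integral_eq_zero
      (η := fun x => ψ x - I * ψ₀ x) (h1.sub (contDiff_const.mul hB1))
      (h2.isCompact.union hB2.isCompact) ⟨2, Or.inr (by rw [hB3]; simp)⟩ (union_subset h3 hB3')
      (fun x hx => by
        by_contra hcon
        rw [mem_union, not_or] at hcon
        exact hx (by simp [image_eq_zero_of_notMem_tsupport hcon.1,
          image_eq_zero_of_notMem_tsupport hcon.2]))
      (by rw [integral_sub iψ (iψ₀.const_mul I), integral_const_mul, hB4]; simp [hI])
    have e2 := h0 φ p1 p2 p3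
    rw [p4] at e2
    have i1 := hint ψ 0 h1 h2 h3
    have i2 := hint ψ₀ 0 hB1 hB2 hB3'
    simp only [sub_zero] at i1 i2
    have e3 : ∫ x, (ψ x - I * ψ₀ x) • h x ∂halfLine
        = ∫ x, ψ x • h x ∂halfLine - I • c := by
      rw [hc, ← integral_smul, ← integral_sub i1 (by exact i2.smul I)]
      congr 1
      ext x
      rw [sub_smul, mul_smul]
    have e4 : ∫ x, ψ x • (h x - c) ∂halfLine = ∫ x, ψ x • h x ∂halfLine - I • c := by
      have : ∫ x, ψ x • c ∂halfLine = I • c := by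
        rw [integral_smul_const, hset ψ h3]
      rw [← this, ← integral_sub i1 (iψ.restrict.smul_const c)]
      congr 1
      ext x
      rw [smul_sub]
    rw [e1, e4, ← e3, e2])
  exact (ae_restrict_iff' measurableSet_Ioi).2 (key.mono fun x hx hx' => sub_eq_zero.1 (hx hx'))

/-- The weak derivative of an `L²` function is the derivative of an absolutely continuous
representative. -/
theorem IsWeakDeriv.exists_isPrimitive {f g : HalfLineL2} (h : IsWeakDeriv f g) :
    ∃ F : ℝ → ℂ, IsPrimitive F g ∧ F =ᵐ[halfLine] f := by
  have hf : MemLp f 2 halfLine := Lp.memLp f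
  have hg : MemLp g 2 halfLine := Lp.memLp g
  have hG := hg.isPrimitive_integral 0
  simp only [zero_add] at hG
  set G : ℝ → ℂ := fun x => ∫ y in (0 : ℝ)..x, g y with hGdef
  have hGi : ∀ b, 0 ≤ b → IntervalIntegrable G volume 0 b := fun b hb =>
    (hG.continuousOn.mono (by rw [uIcc_of_le hb]; exact Icc_subset_Ici_self)).intervalIntegrable
  -- The difference `f - G` has zero weak derivative: the product rule for `φ G` on `[0, d]`, with
  -- `d` beyond the support of `φ`, cancels the weak-derivative identity for `f`.
  obtain ⟨c, hc⟩ := ae_eq_const_of_integral_deriv_smul_eq_zero (h := fun x => f x - G x)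
    (fun b hb => (hf.intervalIntegrable_halfLine hb).sub (hGi b hb)) (fun φ p1 p2 p3 => by
      have d1 : ContDiff ℝ ∞ (deriv φ) := (contDiff_infty_iff_deriv.1 p1).2
      have hφ : IsPrimitive (fun x => (φ x : ℂ)) (fun x => ((deriv φ x : ℝ) : ℂ)) :=
        IsPrimitive.of_hasDerivAt
          (fun x => ((contDiff_infty_iff_deriv.1 p1).1 x).hasDerivAt) d1.continuous
      obtain ⟨b, hb⟩ := p2.isCompact.bddAbove
      have hvan : ∀ x, max b 0 < x → φ x = 0 ∧ deriv φ x = 0 := by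
        intro x hx
        have hx' : x ∉ tsupport φ := fun hmem =>
          absurd (hb hmem) (not_le.2 (lt_of_le_of_lt (le_max_left _ _) hx))
        refine ⟨image_eq_zero_of_notMem_tsupport hx', ?_⟩
        by_contra hne
        exact hx' (support_deriv_subset hne)
      have hφ0 : φ 0 = 0 := image_eq_zero_of_notMem_tsupport fun hmem =>
        lt_irrefl (0 : ℝ) (p3 hmem)
      set d := max b 0 + 1 with hd
      have hd0 : 0 ≤ d := by positivity
      have hprod := (hφ.mul hG).eq_add_integral d hd0
      rw [(hvan d (by linarith)).1, hφ0] at hprod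
      simp only [Complex.ofReal_zero, zero_mul, zero_add] at hprod
      have hred : ∀ k : ℝ → ℂ, (∀ x, max b 0 < x → k x = 0) →
          ∫ x, k x ∂halfLine = ∫ x in (0 : ℝ)..d, k x := by
        intro k hk
        rw [intervalIntegral.integral_of_le hd0]
        refine setIntegral_eq_of_subset_of_forall_sdiff_eq_zero measurableSet_Ioi
          Ioc_subset_Ioi_self fun x hx => hk x ?_
        have h1 : ¬ x ≤ d := fun hle => hx.2 ⟨hx.1, hle⟩
        linarith [not_le.1 h1]
      have hwd := h φ p1 p2 p3
      rw [hred _ fun x hx => by simp [(hvan x hx).2],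
        hred _ fun x hx => by simp [(hvan x hx).1]] at hwd
      rw [hred _ fun x hx => by simp [(hvan x hx).2]]
      have c1 : ContinuousOn (fun x => ((deriv φ x : ℝ) : ℂ)) (uIcc 0 d) :=
        (Complex.continuous_ofReal.comp d1.continuous).continuousOn
      have c2 : ContinuousOn (fun x => (φ x : ℂ)) (uIcc 0 d) :=
        (Complex.continuous_ofReal.comp p1.continuous).continuousOn
      rw [intervalIntegral.integral_add ((hGi d hd0).continuousOn_mul c1)
        ((hG.intervalIntegrable d hd0).continuousOn_mul c2)] at hprod
      simp only [Complex.real_smul] at hwd ⊢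
      simp only [mul_sub]
      rw [intervalIntegral.integral_sub
        ((hf.intervalIntegrable_halfLine hd0).continuousOn_mul c1)
        ((hGi d hd0).continuousOn_mul c1), hwd]
      linear_combination hprod)
  refine ⟨fun x => c + ∫ y in (0 : ℝ)..x, g y, hg.isPrimitive_integral c, ?_⟩
  filter_upwards [hc] with x hx
  rw [← hx]
  simp [hGdef]

/-! ### L² and H¹ estimates on the half-line, with weights -/

section L2

variable {f g : ℝ → ℂ}

theorem MeasureTheory.MemLp.bdd_mul_halfLine {b : ℝ → ℂ} {C : ℝ} (hf : MemLp f 2 halfLine)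
    (hb : AEStronglyMeasurable b halfLine) (hC : ∀ᵐ x ∂halfLine, ‖b x‖ ≤ C) :
    MemLp (fun x => b x * f x) 2 halfLine :=
  hf.of_le_mul (c := C) (hb.mul hf.1) (hC.mono fun x hx => by
    rw [norm_mul]
    exact mul_le_mul_of_nonneg_right hx (norm_nonneg _))

theorem MeasureTheory.MemLp.conj_halfLine (hf : MemLp f 2 halfLine) :
    MemLp (fun x => conj (f x)) 2 halfLine := hf.star

theorem MeasureTheory.MemLp.integrable_mul_halfLine (hf : MemLp f 2 halfLine)
    (hg : MemLp g 2 halfLine) : Integrable (fun x => f x * g x) halfLine :=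
  hf.integrable_mul hg

theorem MeasureTheory.MemLp.integrable_norm_mul_norm (hf : MemLp f 2 halfLine)
    (hg : MemLp g 2 halfLine) : Integrable (fun x => ‖f x‖ * ‖g x‖) halfLine :=
  (hf.integrable_mul_halfLine hg).norm.congr (Eventually.of_forall fun _ => norm_mul _ _)

theorem MeasureTheory.MemLp.integrable_norm_sq (hf : MemLp f 2 halfLine) :
    Integrable (fun x => ‖f x‖ ^ 2) halfLine :=
  (memLp_two_iff_integrable_sq_norm hf.1).1 hf

/-- The Cauchy–Schwarz inequality. -/
theorem integral_norm_mul_norm_le (hf : MemLp f 2 halfLine) (hg : MemLp g 2 halfLine) :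
    ∫ x, ‖f x‖ * ‖g x‖ ∂halfLine ≤
      √(∫ x, ‖f x‖ ^ 2 ∂halfLine) * √(∫ x, ‖g x‖ ^ 2 ∂halfLine) := by
  have h := integral_mul_le_Lp_mul_Lq_of_nonneg (μ := halfLine) Real.HolderConjugate.two_two
    (f := fun x => ‖f x‖) (g := fun x => ‖g x‖)
    (Eventually.of_forall fun x => norm_nonneg _) (Eventually.of_forall fun x => norm_nonneg _)
    (by simpa using hf.norm) (by simpa using hg.norm)
  simpa [Real.sqrt_eq_rpow] using h

theorem integral_complex_re (hf : Integrable f halfLine) :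
    ∫ x, (f x).re ∂halfLine = (∫ x, f x ∂halfLine).re := integral_re hf

theorem integral_complex_im (hf : Integrable f halfLine) :
    ∫ x, (f x).im ∂halfLine = (∫ x, f x ∂halfLine).im := integral_im hf

end L2

/-- As `F` vanishes at infinity, `F x = -∫ f` over `(x, ∞)`. -/
theorem IsPrimitive.norm_le_integral {F f : ℝ → ℂ} (h : IsPrimitive F f)
    (hf : Integrable f halfLine) (hF : Integrable F halfLine) {x : ℝ} (hx : 0 ≤ x) :
    ‖F x‖ ≤ ∫ y, ‖f y‖ ∂halfLine := by
  have h1 := h.integral_Ioi_eq hf hF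
  have h2 := h.eq_add_integral x hx
  have h3 : F x = -∫ y in Ioi x, f y := by
    have h4 := intervalIntegral.integral_Ioi_sub_Ioi (f := f) (μ := volume) hf hx
    rw [h2, ← h4, ← neg_eq_iff_eq_neg.2 h1]
    ring
  rw [h3, norm_neg]
  refine (norm_integral_le_integral_norm _).trans ?_
  exact setIntegral_mono_set hf.norm (Eventually.of_forall fun _ => norm_nonneg _)
    (show Ioi x ≤ Ioi 0 from Ioi_subset_Ioi hx).eventuallyLE

/-- `F ∈ H¹(0, ∞)` with derivative `f`, as functions. -/
structure IsH1 (F f : ℝ → ℂ) : Prop where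
  isPrimitive : IsPrimitive F f
  memLp : MemLp F 2 halfLine
  memLp_deriv : MemLp f 2 halfLine

/-- A bounded `C²` weight `w` with bounded derivatives `w₁`, `w₂`. -/
structure IsWeight (w w₁ w₂ : ℝ → ℝ) : Prop where
  hasDerivAt : ∀ x, HasDerivAt w (w₁ x) x
  hasDerivAt' : ∀ x, HasDerivAt w₁ (w₂ x) x
  continuous : Continuous w₂
  bounded : ∃ C, ∀ x, 0 ≤ x → |w x| ≤ C ∧ |w₁ x| ≤ C ∧ |w₂ x| ≤ C

namespace IsWeight

variable {w w₁ w₂ : ℝ → ℝ} {f : ℝ → ℂ}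

theorem continuous_weight (hw : IsWeight w w₁ w₂) : Continuous w :=
  continuous_iff_continuousAt.2 fun x => (hw.hasDerivAt x).continuousAt

theorem continuous_deriv (hw : IsWeight w w₁ w₂) : Continuous w₁ :=
  continuous_iff_continuousAt.2 fun x => (hw.hasDerivAt' x).continuousAt

theorem memLp_mul_of_continuous {v : ℝ → ℝ} {C : ℝ} (hv : Continuous v)
    (hC : ∀ x, 0 ≤ x → |v x| ≤ C) (hf : MemLp f 2 halfLine) :
    MemLp (fun x => (v x : ℂ) * f x) 2 halfLine :=
  hf.bdd_mul_halfLine (Complex.continuous_ofReal.comp hv).aestronglyMeasurable (C := C)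
    ((ae_restrict_iff' measurableSet_Ioi).2 (Eventually.of_forall fun x hx => by
      simpa using hC x (le_of_lt hx)))

theorem memLp_mul (hw : IsWeight w w₁ w₂) (hf : MemLp f 2 halfLine) :
    MemLp (fun x => (w x : ℂ) * f x) 2 halfLine := by
  obtain ⟨C, hC⟩ := hw.bounded
  exact memLp_mul_of_continuous hw.continuous_weight (fun x hx => (hC x hx).1) hf

theorem memLp_deriv_mul (hw : IsWeight w w₁ w₂) (hf : MemLp f 2 halfLine) :
    MemLp (fun x => (w₁ x : ℂ) * f x) 2 halfLine := by
  obtain ⟨C, hC⟩ := hw.bounded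
  exact memLp_mul_of_continuous hw.continuous_deriv (fun x hx => (hC x hx).2.1) hf

theorem memLp_deriv2_mul (hw : IsWeight w w₁ w₂) (hf : MemLp f 2 halfLine) :
    MemLp (fun x => (w₂ x : ℂ) * f x) 2 halfLine := by
  obtain ⟨C, hC⟩ := hw.bounded
  exact memLp_mul_of_continuous hw.continuous (fun x hx => (hC x hx).2.2) hf

theorem one : IsWeight (fun _ => 1) (fun _ => 0) (fun _ => 0) :=
  ⟨fun x => hasDerivAt_const x 1, fun x => hasDerivAt_const x 0, continuous_const,
    1, fun x _ => by simp⟩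

end IsWeight

namespace IsH1

variable {F G f g : ℝ → ℂ}

theorem star (h : IsH1 F f) : IsH1 (fun x => conj (F x)) (fun x => conj (f x)) :=
  ⟨h.isPrimitive.star, h.memLp.conj_halfLine, h.memLp_deriv.conj_halfLine⟩

theorem sub (h : IsH1 F f) (h' : IsH1 G g) :
    IsH1 (fun x => F x - G x) (fun x => f x - g x) :=
  ⟨h.isPrimitive.sub h'.isPrimitive, h.memLp.sub h'.memLp, h.memLp_deriv.sub h'.memLp_deriv⟩

theorem add (h : IsH1 F f) (h' : IsH1 G g) :
    IsH1 (fun x => F x + G x) (fun x => f x + g x) :=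
  ⟨h.isPrimitive.add h'.isPrimitive, h.memLp.add h'.memLp, h.memLp_deriv.add h'.memLp_deriv⟩

theorem weight_mul {w w₁ w₂ : ℝ → ℝ} (h : IsH1 F f) (hw : IsWeight w w₁ w₂) :
    IsH1 (fun x => (w x : ℂ) * F x) (fun x => (w₁ x : ℂ) * F x + (w x : ℂ) * f x) :=
  ⟨(IsPrimitive.of_hasDerivAt hw.hasDerivAt hw.continuous_deriv).mul h.isPrimitive,
    hw.memLp_mul h.memLp, (hw.memLp_deriv_mul h.memLp).add (hw.memLp_mul h.memLp_deriv)⟩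

theorem deriv_weight_mul {w w₁ w₂ : ℝ → ℝ} (h : IsH1 F f) (hw : IsWeight w w₁ w₂) :
    IsH1 (fun x => (w₁ x : ℂ) * F x) (fun x => (w₂ x : ℂ) * F x + (w₁ x : ℂ) * f x) :=
  ⟨(IsPrimitive.of_hasDerivAt hw.hasDerivAt' hw.continuous).mul h.isPrimitive,
    hw.memLp_deriv_mul h.memLp,
    (hw.memLp_deriv2_mul h.memLp).add (hw.memLp_deriv_mul h.memLp_deriv)⟩

theorem integrable_mul_deriv (h : IsH1 F f) (h' : IsH1 G g) :
    Integrable (fun x => f x * G x + F x * g x) halfLine :=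
  (h.memLp_deriv.integrable_mul_halfLine h'.memLp).add
    (h.memLp.integrable_mul_halfLine h'.memLp_deriv)

/-- Integration by parts on the half-line. -/
theorem integral_mul_deriv (h : IsH1 F f) (h' : IsH1 G g) :
    ∫ x, (f x * G x + F x * g x) ∂halfLine = -(F 0 * G 0) :=
  (h.isPrimitive.mul h'.isPrimitive).integral_Ioi_eq (h.integrable_mul_deriv h')
    (h.memLp.integrable_mul_halfLine h'.memLp)

theorem integrable_mul_deriv_re (h : IsH1 F f) (h' : IsH1 G g) :
    Integrable (fun x => (f x * G x + F x * g x).re) halfLine :=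
  (h.integrable_mul_deriv h').re

theorem integrable_mul_deriv_im (h : IsH1 F f) (h' : IsH1 G g) :
    Integrable (fun x => (f x * G x + F x * g x).im) halfLine :=
  (h.integrable_mul_deriv h').im

theorem integral_mul_deriv_re (h : IsH1 F f) (h' : IsH1 G g) :
    ∫ x, (f x * G x + F x * g x).re ∂halfLine = -(F 0 * G 0).re :=
  (integral_complex_re (h.integrable_mul_deriv h')).trans
    (congrArg Complex.re (h.integral_mul_deriv h'))

theorem integral_mul_deriv_im (h : IsH1 F f) (h' : IsH1 G g) :
    ∫ x, (f x * G x + F x * g x).im ∂halfLine = -(F 0 * G 0).im :=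
  (integral_complex_im (h.integrable_mul_deriv h')).trans
    (congrArg Complex.im (h.integral_mul_deriv h'))

/-- Apply the previous bound to `|F|²`, whose derivative is `2 Re(F̄ f)`. Keeping only the real part
matters later: it is unchanged when `f` is modified by a real phase gradient, i.e. by an imaginary
multiple of `F`. -/
theorem norm_sq_le_integral (h : IsH1 F f) {x : ℝ} (hx : 0 ≤ x) :
    ‖F x‖ ^ 2 ≤ 2 * ∫ y, |(conj (F y) * f y).re| ∂halfLine := by
  have h1 := (h.isPrimitive.mul h.star.isPrimitive).norm_le_integral
    (h.integrable_mul_deriv h.star) (h.memLp.integrable_mul_halfLine h.star.memLp) hx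
  rw [Complex.mul_conj', ← Complex.ofReal_pow, Complex.norm_real, Real.norm_of_nonneg
    (by positivity)] at h1
  refine h1.trans (le_of_eq ?_)
  rw [← integral_const_mul]
  congr 1
  ext y
  have : f y * conj (F y) + F y * conj (f y) = ((2 * (conj (F y) * f y).re : ℝ) : ℂ) := by
    apply Complex.ext <;> simp <;> ring
  rw [this, Complex.norm_real, Real.norm_eq_abs, abs_mul, abs_two]

theorem norm_sq_le (h : IsH1 F f) {x : ℝ} (hx : 0 ≤ x) :
    ‖F x‖ ^ 2 ≤ 2 * (√(∫ y, ‖F y‖ ^ 2 ∂halfLine) * √(∫ y, ‖f y‖ ^ 2 ∂halfLine)) := by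
  refine (h.norm_sq_le_integral hx).trans ?_
  gcongr
  refine le_trans ?_ (integral_norm_mul_norm_le h.memLp h.memLp_deriv)
  refine integral_mono ?_ (h.memLp.integrable_norm_mul_norm h.memLp_deriv) fun y => ?_
  · exact (h.star.memLp.integrable_mul_halfLine h.memLp_deriv).re.abs
  · exact (Complex.abs_re_le_norm _).trans (by simp)

theorem exists_bound (h : IsH1 F f) : ∃ C, ∀ x, 0 ≤ x → ‖F x‖ ≤ C :=
  ⟨_, fun _ hx => Real.le_sqrt_of_sq_le (h.norm_sq_le hx)⟩

theorem memLp_mul (h : IsH1 F f) (hg : MemLp g 2 halfLine) :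
    MemLp (fun x => F x * g x) 2 halfLine := by
  obtain ⟨C, hC⟩ := h.exists_bound
  exact hg.bdd_mul_halfLine h.memLp.1 (C := C) ((ae_restrict_iff' measurableSet_Ioi).2
    (Eventually.of_forall fun x hx => hC x (le_of_lt hx)))

theorem mul (h : IsH1 F f) (h' : IsH1 G g) :
    IsH1 (fun x => F x * G x) (fun x => f x * G x + F x * g x) :=
  ⟨h.isPrimitive.mul h'.isPrimitive, h.memLp_mul h'.memLp, by
    have h1 := (h'.memLp_mul h.memLp_deriv).add (h.memLp_mul h'.memLp_deriv)
    refine h1.congr_norm ?_ ?_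
    · exact (h.memLp_deriv.1.mul h'.memLp.1).add (h.memLp.1.mul h'.memLp_deriv.1)
    · exact Eventually.of_forall fun x => by simp [mul_comm]⟩

theorem integrable_norm_pow_four (h : IsH1 F f) : Integrable (fun x => ‖F x‖ ^ 4) halfLine := by
  have := (h.mul h.star).memLp.integrable_norm_sq
  refine this.congr (Eventually.of_forall fun x => ?_)
  simp only [norm_mul, RCLike.norm_conj]
  ring

end IsH1

/-! ### Spatial identities behind the balance laws -/

/-- The right-hand side `i (q_xx - 2 |q|² q)` of the equation. -/
noncomputable def nlsField (q r : ℝ → ℂ) (x : ℝ) : ℂ :=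
  Complex.I * (r x - 2 * ((‖q x‖ : ℂ) ^ 2 * q x))

section Space

variable {q p r : ℝ → ℂ} {w w₁ w₂ : ℝ → ℝ}

/-- Integrate `q̄ · (w p)` by parts. The nonlinearity drops out because `q̄ · i|q|²q` is purely
imaginary. -/
theorem integral_mass_identity (hq : IsH1 q p) (hp : IsH1 p r) (hw : IsWeight w w₁ w₂) :
    ∫ x, (conj (2 * ((w x : ℂ) * q x)) * nlsField q r x).re ∂halfLine =
      2 * w 0 * (conj (q 0) * p 0).im + 2 * ∫ x, w₁ x * (conj (q x) * p x).im ∂halfLine := by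
  have hA := hq.star.integral_mul_deriv_im (hp.weight_mul hw)
  have iA := hq.star.integrable_mul_deriv_im (hp.weight_mul hw)
  have iB : Integrable (fun x => w₁ x * (conj (q x) * p x).im) halfLine := by
    refine ((hw.memLp_deriv_mul hq.star.memLp).integrable_mul_halfLine hp.memLp).im.congr
      (Eventually.of_forall fun x => ?_)
    simp
    ring
  have e : ∀ x, (conj (2 * ((w x : ℂ) * q x)) * nlsField q r x).re =
      -2 * (conj (p x) * ((w x : ℂ) * p x) +
        conj (q x) * ((w₁ x : ℂ) * p x + (w x : ℂ) * r x)).im +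
      2 * (w₁ x * (conj (q x) * p x).im) := by
    intro x
    rw [nlsField, ← Complex.mul_conj']
    simp
    ring
  simp_rw [e]
  rw [integral_add (iA.const_mul (-2)) (iB.const_mul 2), integral_const_mul, integral_const_mul, hA]
  simp
  ring

/-- The multiplier `-i(2w p + w₁ q)` is the L² gradient of `∫ w Im(q̄ q_x)`. Three integrations by
parts, for `w|p|²`, `w|q|⁴` and `w₁ Re(q̄ p)`, give the boundary terms. -/
theorem integral_momentum_identity (hq : IsH1 q p) (hp : IsH1 p r) (hw : IsWeight w w₁ w₂) :
    ∫ x, (conj (-Complex.I * (2 * ((w x : ℂ) * p x) + (w₁ x : ℂ) * q x)) *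
        nlsField q r x).re ∂halfLine =
      (∫ x, (w₁ x * (2 * ‖p x‖ ^ 2 + ‖q x‖ ^ 4) + w₂ x * (conj (q x) * p x).re) ∂halfLine) +
        w 0 * ‖p 0‖ ^ 2 - w 0 * ‖q 0‖ ^ 4 + w₁ 0 * (conj (q 0) * p 0).re := by
  have hA := (hp.weight_mul hw).integral_mul_deriv_re hp.star
  have iA := (hp.weight_mul hw).integrable_mul_deriv_re hp.star
  have hB := ((hq.mul hq.star).weight_mul hw).integral_mul_deriv_re (hq.mul hq.star)
  have iB := ((hq.mul hq.star).weight_mul hw).integrable_mul_deriv_re (hq.mul hq.star)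
  have hC := (hq.star.deriv_weight_mul hw).integral_mul_deriv_re hp
  have iC := (hq.star.deriv_weight_mul hw).integrable_mul_deriv_re hp
  have iD : Integrable (fun x => w₁ x * (2 * ‖p x‖ ^ 2 + ‖q x‖ ^ 4) +
      w₂ x * (conj (q x) * p x).re) halfLine := by
    have i1 := ((hw.memLp_deriv_mul hp.memLp).integrable_mul_halfLine hp.star.memLp).const_mul 2
    have i2 := (hw.memLp_deriv_mul (hq.mul hq.star).memLp).integrable_mul_halfLine
      (hq.mul hq.star).memLp
    have i3 := (hw.memLp_deriv2_mul hq.star.memLp).integrable_mul_halfLine hp.memLp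
    refine ((i1.add i2).add i3).re.congr (Eventually.of_forall fun x => ?_)
    simp only [show ‖q x‖ ^ 4 = (‖q x‖ ^ 2) ^ 2 by ring, Complex.sq_norm, Complex.normSq_apply]
    simp
    ring
  have e : ∀ x, (conj (-Complex.I * (2 * ((w x : ℂ) * p x) + (w₁ x : ℂ) * q x)) *
        nlsField q r x).re =
      (w₁ x * (2 * ‖p x‖ ^ 2 + ‖q x‖ ^ 4) + w₂ x * (conj (q x) * p x).re) -
      (((w₁ x : ℂ) * p x + (w x : ℂ) * r x) * conj (p x) + (w x : ℂ) * p x * conj (r x)).re +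
      (((w₁ x : ℂ) * (q x * conj (q x)) + (w x : ℂ) * (p x * conj (q x) + q x * conj (p x))) *
        (q x * conj (q x)) + (w x : ℂ) * (q x * conj (q x)) *
        (p x * conj (q x) + q x * conj (p x))).re -
      (((w₂ x : ℂ) * conj (q x) + (w₁ x : ℂ) * conj (p x)) * p x +
        (w₁ x : ℂ) * conj (q x) * r x).re := by
    intro x
    rw [nlsField, ← Complex.mul_conj']
    simp only [show ‖q x‖ ^ 4 = (‖q x‖ ^ 2) ^ 2 by ring, Complex.sq_norm, Complex.normSq_apply]
    simp
    ring
  simp_rw [e]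
  rw [integral_sub (by exact (iD.sub iA).add iB) iC, integral_add (by exact iD.sub iA) iB,
    integral_sub iD iA, hA, hB, hC]
  simp only [show ‖q 0‖ ^ 4 = (‖q 0‖ ^ 2) ^ 2 by ring, Complex.sq_norm, Complex.normSq_apply]
  simp
  ring

/-- Hamiltonian structure: the field is `-i/2` times the energy gradient, so the two are orthogonal
pointwise. -/
theorem re_energy_density_eq_zero (x : ℝ) :
    (conj (-(2 * r x) + 4 * ((‖q x‖ : ℂ) ^ 2 * q x)) * nlsField q r x).re = 0 := by
  rw [nlsField, ← Complex.mul_conj']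
  simp
  ring

end Space

/-! ### Inner products, multipliers and time differentiation in L² -/

section LpTools

theorem norm_sq_halfLineL2 {f : HalfLineL2} {f' : ℝ → ℂ} (h : f' =ᵐ[halfLine] f) :
    ‖f‖ ^ 2 = ∫ x, ‖f' x‖ ^ 2 ∂halfLine := by
  have h1 : ((‖f‖ ^ 2 : ℝ) : ℂ) = inner ℂ f f := by
    rw [inner_self_eq_norm_sq_to_K]; simp
  rw [L2.inner_def] at h1
  have h2 : ∫ x, inner ℂ (f x) (f x) ∂halfLine = ∫ x, ((‖f' x‖ ^ 2 : ℝ) : ℂ) ∂halfLine := by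
    refine integral_congr_ae (h.mono fun x hx => ?_)
    simp only [← hx, inner_self_eq_norm_sq_to_K]
    simp
  rw [h2, integral_complex_ofReal] at h1
  exact_mod_cast h1

theorem norm_halfLineL2 {f : HalfLineL2} {f' : ℝ → ℂ} (h : f' =ᵐ[halfLine] f) :
    √(∫ x, ‖f' x‖ ^ 2 ∂halfLine) = ‖f‖ := by
  rw [← norm_sq_halfLineL2 h, Real.sqrt_sq (norm_nonneg _)]

theorem re_inner_halfLineL2 {f g : HalfLineL2} {f' g' : ℝ → ℂ} (hf : f' =ᵐ[halfLine] f)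
    (hg : g' =ᵐ[halfLine] g) :
    (inner ℂ f g).re = ∫ x, (conj (f' x) * g' x).re ∂halfLine := by
  rw [L2.inner_def, ← integral_complex_re (L2.integrable_inner f g)]
  refine integral_congr_ae ?_
  filter_upwards [hf, hg] with x h1 h2
  rw [← h1, ← h2, RCLike.inner_apply, mul_comm]

/-- Multiplication by a bounded weight, as an operator on `L²(0, ∞)`. -/
theorem exists_weight_mul_clm {w : ℝ → ℝ} {C : ℝ} (hw : Continuous w)
    (hC : ∀ x, 0 ≤ x → |w x| ≤ C) :
    ∃ T : HalfLineL2 →L[ℂ] HalfLineL2, ∀ f : HalfLineL2, ∀ f' : ℝ → ℂ, f' =ᵐ[halfLine] f →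
      (fun x => (w x : ℂ) * f' x) =ᵐ[halfLine] T f := by
  have hm : ∀ f : HalfLineL2, MemLp (fun x => (w x : ℂ) * f x) 2 halfLine := fun f =>
    IsWeight.memLp_mul_of_continuous hw hC (Lp.memLp f)
  let L : HalfLineL2 →ₗ[ℂ] HalfLineL2 :=
    { toFun := fun f => (hm f).toLp
      map_add' := fun f g => by
        apply Lp.ext
        filter_upwards [(hm (f + g)).coeFn_toLp, (hm f).coeFn_toLp, (hm g).coeFn_toLp,
          Lp.coeFn_add f g, Lp.coeFn_add (hm f).toLp (hm g).toLp] with x h1 h2 h3 h4 h5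
        rw [h1, h5, Pi.add_apply, h2, h3, h4, Pi.add_apply, mul_add]
      map_smul' := fun c f => by
        apply Lp.ext
        filter_upwards [(hm (c • f)).coeFn_toLp, (hm f).coeFn_toLp,
          Lp.coeFn_smul c f, Lp.coeFn_smul c (hm f).toLp] with x h1 h2 h3 h4
        simp only [RingHom.id_apply]
        rw [h1, h4, Pi.smul_apply, h2, h3, Pi.smul_apply, smul_eq_mul, smul_eq_mul]
        ring }
  refine ⟨L.mkContinuous C fun f => ?_, fun f f' hf => ?_⟩
  · refine Lp.norm_le_mul_norm_of_ae_le_mul ?_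
    filter_upwards [(hm f).coeFn_toLp, ae_restrict_mem measurableSet_Ioi] with x h1 h2
    change ‖(hm f).toLp _ x‖ ≤ _
    rw [h1, norm_mul, Complex.norm_real]
    exact mul_le_mul_of_nonneg_right (hC x (le_of_lt h2)) (norm_nonneg _)
  · filter_upwards [(hm f).coeFn_toLp, hf] with x h1 h2
    change _ = (hm f).toLp _ x
    rw [h1, h2]

/-- Only `U` and the boundary value are differentiable in time. If the increment of `F` is exactly
linear in their increments, with coefficients `G`, `c` that are merely continuous, dividing by `τ -
t` and passing to the limit differentiates `F`. Integration by parts in space moves any derivative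
off the increment of `q`. -/
theorem hasDerivWithinAt_of_sub_eq_inner {F : ℝ → ℝ} {U G : ℝ → HalfLineL2} {b c : ℝ → ℂ}
    {v : HalfLineL2} {b' : ℂ} {s : Set ℝ} {t : ℝ}
    (hU : HasDerivWithinAt U v s t) (hG : ContinuousWithinAt G s t)
    (hb : HasDerivWithinAt b b' s t) (hc : ContinuousWithinAt c s t)
    (hF : ∀ τ ∈ s, F τ - F t =
      (inner ℂ (G τ) (U τ - U t)).re + (conj (c τ) * (b τ - b t)).re) :
    HasDerivWithinAt F ((inner ℂ (G t) v).re + (conj (c t) * b').re) s t := by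
  rw [hasDerivWithinAt_iff_tendsto_slope] at hU hb ⊢
  have hG' := hG.mono_left (nhdsWithin_mono t (sdiff_subset (s := s) (t := {t})))
  have hc' := hc.mono_left (nhdsWithin_mono t (sdiff_subset (s := s) (t := {t})))
  have h1 := (Complex.continuous_re.tendsto _).comp (Filter.Tendsto.inner (𝕜 := ℂ) hG' hU)
  have h2 := (Complex.continuous_re.tendsto _).comp
    (((Complex.continuous_conj.tendsto _).comp hc').mul hb)
  refine (h1.add h2).congr' ?_
  filter_upwards [self_mem_nhdsWithin] with τ hτ
  simp only [Function.comp_apply, slope_def_module]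
  rw [hF τ hτ.1, smul_eq_mul, mul_add]
  congr 1
  · rw [inner_smul_right_eq_smul, Complex.smul_re, smul_eq_mul]
  · rw [Complex.real_smul, mul_left_comm, Complex.re_ofReal_mul]

end LpTools

theorem IsWeight.integrable_mul_norm_sq {w w₁ w₂ : ℝ → ℝ} (hw : IsWeight w w₁ w₂) {f : ℝ → ℂ}
    (hf : MemLp f 2 halfLine) :
    Integrable (fun x => w x * ‖f x‖ ^ 2) halfLine := by
  refine ((hw.memLp_mul hf).integrable_mul_halfLine hf.conj_halfLine).re.congr
    (Eventually.of_forall fun x => ?_)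
  simp only [Complex.sq_norm, Complex.normSq_apply]
  simp
  ring

/-! ### Balance laws for mass, momentum and energy -/

/-- A solution of the cubic NLS equation on the half-line in `C¹(L²) ∩ C⁰(H²)`, given by functions
`q t`, `p t = q_x`, `r t = q_xx` and by the `L²` classes `U`, `P`, `R` of these; `V` is the time
derivative of `U`, and `b` the one of the boundary value. -/
structure IsRegularSolution (q p r : ℝ → ℝ → ℂ) (b : ℝ → ℂ) (U P R V : ℝ → HalfLineL2) :
    Prop where
  continuousOn_U : ContinuousOn U (Ici 0)
  continuousOn_P : ContinuousOn P (Ici 0)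
  continuousOn_R : ContinuousOn R (Ici 0)
  hasDerivWithinAt_U : ∀ t, 0 ≤ t → HasDerivWithinAt U (V t) (Ici 0) t
  ae_eq_U : ∀ t, 0 ≤ t → q t =ᵐ[halfLine] U t
  ae_eq_P : ∀ t, 0 ≤ t → p t =ᵐ[halfLine] P t
  ae_eq_R : ∀ t, 0 ≤ t → r t =ᵐ[halfLine] R t
  isPrimitive_q : ∀ t, 0 ≤ t → IsPrimitive (q t) (p t)
  isPrimitive_p : ∀ t, 0 ≤ t → IsPrimitive (p t) (r t)
  equation : ∀ t, 0 < t → nlsField (q t) (r t) =ᵐ[halfLine] V t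
  hasDerivWithinAt_boundary : ∀ t, 0 ≤ t → HasDerivWithinAt (fun s => q s 0) (b t) (Ici 0) t
  continuousOn_b : ContinuousOn b (Ici 0)

namespace IsRegularSolution

variable {q p r : ℝ → ℝ → ℂ} {b : ℝ → ℂ} {U P R V : ℝ → HalfLineL2} {t : ℝ} {w w₁ w₂ : ℝ → ℝ}

section
variable (H : IsRegularSolution q p r b U P R V)
include H

theorem isH1_q (ht : 0 ≤ t) : IsH1 (q t) (p t) :=
  ⟨H.isPrimitive_q t ht, (memLp_congr_ae (H.ae_eq_U t ht)).2 (Lp.memLp _),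
    (memLp_congr_ae (H.ae_eq_P t ht)).2 (Lp.memLp _)⟩

theorem isH1_p (ht : 0 ≤ t) : IsH1 (p t) (r t) :=
  ⟨H.isPrimitive_p t ht, (memLp_congr_ae (H.ae_eq_P t ht)).2 (Lp.memLp _),
    (memLp_congr_ae (H.ae_eq_R t ht)).2 (Lp.memLp _)⟩

theorem norm_q_sq_le (ht : 0 ≤ t) {x : ℝ} (hx : 0 ≤ x) : ‖q t x‖ ^ 2 ≤ 2 * (‖U t‖ * ‖P t‖) := by
  rw [← norm_halfLineL2 (H.ae_eq_U t ht), ← norm_halfLineL2 (H.ae_eq_P t ht)]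
  exact (H.isH1_q ht).norm_sq_le hx

theorem ae_eq_sub_P {s : ℝ} (hs : 0 ≤ s) (ht : 0 ≤ t) :
    (fun x => p s x - p t x) =ᵐ[halfLine] (P s - P t : HalfLineL2) := by
  filter_upwards [H.ae_eq_P s hs, H.ae_eq_P t ht, Lp.coeFn_sub (P s) (P t)] with x h1 h2 h3
  rw [h3, h1, h2, Pi.sub_apply]

theorem ae_eq_sub_R {s : ℝ} (hs : 0 ≤ s) (ht : 0 ≤ t) :
    (fun x => r s x - r t x) =ᵐ[halfLine] (R s - R t : HalfLineL2) := by
  filter_upwards [H.ae_eq_R s hs, H.ae_eq_R t ht, Lp.coeFn_sub (R s) (R t)] with x h1 h2 h3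
  rw [h3, h1, h2, Pi.sub_apply]

theorem ae_eq_sub_U {s : ℝ} (hs : 0 ≤ s) (ht : 0 ≤ t) :
    (fun x => q s x - q t x) =ᵐ[halfLine] (U s - U t : HalfLineL2) := by
  filter_upwards [H.ae_eq_U s hs, H.ae_eq_U t ht, Lp.coeFn_sub (U s) (U t)] with x h1 h2 h3
  rw [h3, h1, h2, Pi.sub_apply]

/-- The trace of `p s - p t` is bounded by the L² norms of this difference and of its derivative. -/
theorem continuousOn_p_zero : ContinuousOn (fun t => p t 0) (Ici 0) := by
  intro t ht
  have h1 : Tendsto (fun s => √(2 * (‖P s - P t‖ * ‖R s - R t‖))) (𝓝[Ici 0] t) (𝓝 0) := by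
    have hP := ((H.continuousOn_P t ht).tendsto.sub_const (P t)).norm
    have hR := ((H.continuousOn_R t ht).tendsto.sub_const (R t)).norm
    simpa using ((hP.mul hR).const_mul 2).sqrt
  rw [ContinuousWithinAt, tendsto_iff_norm_sub_tendsto_zero]
  refine squeeze_zero' (Eventually.of_forall fun _ => norm_nonneg _) ?_ h1
  filter_upwards [self_mem_nhdsWithin] with s hs
  refine Real.le_sqrt_of_sq_le ?_
  rw [← norm_halfLineL2 (H.ae_eq_sub_P hs ht), ← norm_halfLineL2 (H.ae_eq_sub_R hs ht)]
  exact ((H.isH1_p hs).sub (H.isH1_p ht)).norm_sq_le le_rfl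

theorem integrable_weight_im (hw : IsWeight w w₁ w₂) (ht : 0 ≤ t) :
    Integrable (fun x => w x * (conj (q t x) * p t x).im) halfLine := by
  refine ((hw.memLp_mul (H.isH1_q ht).star.memLp).integrable_mul_halfLine
    (H.isH1_q ht).memLp_deriv).im.congr (Eventually.of_forall fun x => ?_)
  simp
  ring

/-- The representative `v` is left free so that `t = 0`, where the equation is not assumed, is
covered too; there the lemma supplies continuity. The increment identity is `|z|² - |y|² = Re(conj(z
+ y)(z - y))`. The momentum and energy versions follow the same pattern. -/
theorem hasDerivWithinAt_mass_aux (hw : IsWeight w w₁ w₂) (ht : 0 ≤ t) {v : ℝ → ℂ}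
    (hv : v =ᵐ[halfLine] V t) :
    HasDerivWithinAt (fun s => ∫ x, w x * ‖q s x‖ ^ 2 ∂halfLine)
      (∫ x, (conj (2 * ((w x : ℂ) * q t x)) * v x).re ∂halfLine) (Ici 0) t := by
  obtain ⟨C, hC⟩ := hw.bounded
  obtain ⟨T, hT⟩ := exists_weight_mul_clm hw.continuous_weight fun x hx => (hC x hx).1
  have hadd : ∀ s, 0 ≤ s →
      (fun x => q s x + q t x) =ᵐ[halfLine] (U s + U t : HalfLineL2) := by
    intro s hs
    filter_upwards [H.ae_eq_U s hs, H.ae_eq_U t ht, Lp.coeFn_add (U s) (U t)] with x h1 h2 h3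
    rw [h3, h1, h2, Pi.add_apply]
  have key := hasDerivWithinAt_of_sub_eq_inner (F := fun s => ∫ x, w x * ‖q s x‖ ^ 2 ∂halfLine)
    (G := fun s => T (U s + U t)) (b := fun _ => 0) (c := fun _ => 0)
    (H.hasDerivWithinAt_U t ht)
    (T.continuous.continuousAt.comp_continuousWithinAt
      ((H.continuousOn_U t ht).add continuousWithinAt_const))
    (hasDerivWithinAt_const _ _ _) continuousWithinAt_const (fun s hs => by
      rw [re_inner_halfLineL2 (hT _ _ (hadd s hs)) (H.ae_eq_sub_U hs ht),
        ← integral_sub (hw.integrable_mul_norm_sq (H.isH1_q hs).memLp)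
          (hw.integrable_mul_norm_sq (H.isH1_q ht).memLp)]
      simp only [mul_zero, map_zero, sub_zero, Complex.zero_re, add_zero]
      congr 1
      ext x
      simp only [Complex.sq_norm, Complex.normSq_apply]
      simp
      ring)
  convert key using 1
  rw [re_inner_halfLineL2 (hT _ _ (hadd t ht)) hv]
  simp [two_mul, mul_add]

theorem continuousOn_mass (hw : IsWeight w w₁ w₂) :
    ContinuousOn (fun s => ∫ x, w x * ‖q s x‖ ^ 2 ∂halfLine) (Ici 0) := fun _ ht =>
  (H.hasDerivWithinAt_mass_aux hw ht Filter.EventuallyEq.rfl).continuousWithinAt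

theorem hasDerivAt_mass (hw : IsWeight w w₁ w₂) (ht : 0 < t) :
    HasDerivAt (fun s => ∫ x, w x * ‖q s x‖ ^ 2 ∂halfLine)
      (2 * w 0 * (conj (q t 0) * p t 0).im +
        2 * ∫ x, w₁ x * (conj (q t x) * p t x).im ∂halfLine) t := by
  rw [← integral_mass_identity (H.isH1_q ht.le) (H.isH1_p ht.le) hw]
  exact (H.hasDerivWithinAt_mass_aux hw ht.le (H.equation t ht)).hasDerivAt (Ici_mem_nhds ht)

theorem hasDerivWithinAt_momentum_aux (hw : IsWeight w w₁ w₂) (ht : 0 ≤ t) {v : ℝ → ℂ}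
    (hv : v =ᵐ[halfLine] V t) :
    HasDerivWithinAt (fun s => ∫ x, w x * (conj (q s x) * p s x).im ∂halfLine)
      ((∫ x, (conj (-Complex.I * (2 * ((w x : ℂ) * p t x) + (w₁ x : ℂ) * q t x)) *
        v x).re ∂halfLine) - w 0 * (conj (q t 0) * b t).im) (Ici 0) t := by
  obtain ⟨C, hC⟩ := hw.bounded
  obtain ⟨T, hT⟩ := exists_weight_mul_clm hw.continuous_weight fun x hx => (hC x hx).1
  obtain ⟨T', hT'⟩ := exists_weight_mul_clm hw.continuous_deriv fun x hx => (hC x hx).2.1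
  have hG : ∀ s, 0 ≤ s →
      (fun x => -Complex.I * ((w x : ℂ) * (p s x + p t x) + (w₁ x : ℂ) * q t x)) =ᵐ[halfLine]
      (-Complex.I • (T (P s + P t) + T' (U t)) : HalfLineL2) := by
    intro s hs
    have hadd : (fun x => p s x + p t x) =ᵐ[halfLine] (P s + P t : HalfLineL2) := by
      filter_upwards [H.ae_eq_P s hs, H.ae_eq_P t ht, Lp.coeFn_add (P s) (P t)] with x h1 h2 h3
      rw [h3, h1, h2, Pi.add_apply]
    filter_upwards [hT _ _ hadd, hT' _ _ (H.ae_eq_U t ht),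
      Lp.coeFn_add (T (P s + P t)) (T' (U t)),
      Lp.coeFn_smul (-Complex.I) (T (P s + P t) + T' (U t))] with x h1 h2 h3 h4
    rw [h4, Pi.smul_apply, h3, Pi.add_apply, h1, h2, smul_eq_mul]
  have hTc : Continuous fun y : HalfLineL2 => -Complex.I • (T (y + P t) + T' (U t)) := by
    fun_prop
  have key := hasDerivWithinAt_of_sub_eq_inner
    (F := fun s => ∫ x, w x * (conj (q s x) * p s x).im ∂halfLine)
    (G := fun s => -Complex.I • (T (P s + P t) + T' (U t))) (b := fun s => q s 0)
    (c := fun _ => -Complex.I * ((w 0 : ℂ) * q t 0))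
    (H.hasDerivWithinAt_U t ht)
    (hTc.continuousAt.comp_continuousWithinAt (H.continuousOn_P t ht))
    (H.hasDerivWithinAt_boundary t ht) continuousWithinAt_const (fun s hs => by
      have hs' : 0 ≤ s := hs
      have hd := (H.isH1_q hs').sub (H.isH1_q ht)
      have hA := ((H.isH1_q ht).star.weight_mul hw).integral_mul_deriv_im hd
      have iA := ((H.isH1_q ht).star.weight_mul hw).integrable_mul_deriv_im hd
      rw [re_inner_halfLineL2 (hG s hs) (H.ae_eq_sub_U hs ht),
        ← integral_sub (H.integrable_weight_im hw hs) (H.integrable_weight_im hw ht)]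
      -- The last summand is the derivative of `w q̄_t (q_s - q_t)`, so its integral is the boundary
      -- contribution; the first pairs the increment of `q` with the symmetrised gradient.
      have e : ∀ x, w x * (conj (q s x) * p s x).im - w x * (conj (q t x) * p t x).im =
          (conj (-Complex.I * ((w x : ℂ) * (p s x + p t x) + (w₁ x : ℂ) * q t x)) *
            (q s x - q t x)).re +
          (((w₁ x : ℂ) * conj (q t x) + (w x : ℂ) * conj (p t x)) * (q s x - q t x) +
            (w x : ℂ) * conj (q t x) * (p s x - p t x)).im := by
        intro x
        simp
        ring
      have iB : Integrable (fun x => (conj (-Complex.I * ((w x : ℂ) * (p s x + p t x) +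
          (w₁ x : ℂ) * q t x)) * (q s x - q t x)).re) halfLine := by
        have m1 := ((hw.memLp_mul ((H.isH1_q hs').memLp_deriv.add
          (H.isH1_q ht).memLp_deriv)).add (hw.memLp_deriv_mul (H.isH1_q ht).memLp)).const_mul
            (-Complex.I)
        exact (m1.conj_halfLine.integrable_mul_halfLine hd.memLp).re
      simp_rw [e]
      rw [integral_add iB iA, hA]
      congr 1
      simp
      ring)
  convert key using 1
  rw [re_inner_halfLineL2 (hG t ht) hv, sub_eq_add_neg]
  congr 1
  · simp [two_mul, mul_add]
  · simp
    ring

theorem continuousOn_momentum (hw : IsWeight w w₁ w₂) :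
    ContinuousOn (fun s => ∫ x, w x * (conj (q s x) * p s x).im ∂halfLine) (Ici 0) := fun _ ht =>
  (H.hasDerivWithinAt_momentum_aux hw ht Filter.EventuallyEq.rfl).continuousWithinAt

theorem hasDerivAt_momentum (hw : IsWeight w w₁ w₂) (ht : 0 < t) :
    HasDerivAt (fun s => ∫ x, w x * (conj (q s x) * p s x).im ∂halfLine)
      ((∫ x, (w₁ x * (2 * ‖p t x‖ ^ 2 + ‖q t x‖ ^ 4) +
          w₂ x * (conj (q t x) * p t x).re) ∂halfLine) +
        w 0 * ‖p t 0‖ ^ 2 - w 0 * ‖q t 0‖ ^ 4 + w₁ 0 * (conj (q t 0) * p t 0).re -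
        w 0 * (conj (q t 0) * b t).im) t := by
  rw [← integral_momentum_identity (H.isH1_q ht.le) (H.isH1_p ht.le) hw]
  exact (H.hasDerivWithinAt_momentum_aux hw ht.le (H.equation t ht)).hasDerivAt (Ici_mem_nhds ht)

/-- Coefficient in `|z|⁴ - |y|⁴ = Re(conj((|z|² + |y|²)(z + y))(z - y))`. It is continuous in L²
because `q` is bounded in space, locally uniformly in time. -/
theorem exists_quartic_gradient (ht : 0 ≤ t) :
    ∃ N : ℝ → HalfLineL2, ContinuousWithinAt N (Ici 0) t ∧ ∀ s, 0 ≤ s →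
      (fun x => ((‖q s x‖ : ℂ) ^ 2 + (‖q t x‖ : ℂ) ^ 2) * (q s x + q t x)) =ᵐ[halfLine] N s := by
  have hm : ∀ s, 0 ≤ s →
      MemLp (fun x => ((‖q s x‖ : ℂ) ^ 2 + (‖q t x‖ : ℂ) ^ 2) * (q s x + q t x)) 2 halfLine := by
    intro s hs
    have h1 := (((H.isH1_q hs).mul (H.isH1_q hs).star).add
      ((H.isH1_q ht).mul (H.isH1_q ht).star)).memLp_mul ((H.isH1_q hs).memLp.add (H.isH1_q ht).memLp)
    simp only [Complex.mul_conj'] at h1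
    exact h1
  classical
  refine ⟨fun s => if hs : 0 ≤ s then (hm s hs).toLp else 0, ?_, fun s hs => by
    simpa only [hs, dite_true] using! (hm s hs).coeFn_toLp.symm⟩
  rw [ContinuousWithinAt, tendsto_iff_norm_sub_tendsto_zero]
  set B : ℝ := 2 * (‖U t‖ * ‖P t‖) + 1 with hB
  have hB0 : 0 ≤ B := by positivity
  have hev : ∀ᶠ s in 𝓝[Ici 0] t, 2 * (‖U s‖ * ‖P s‖) < B := by
    have h1 : ContinuousWithinAt (fun s => 2 * (‖U s‖ * ‖P s‖)) (Ici 0) t :=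
      continuousWithinAt_const.mul ((H.continuousOn_U t ht).norm.mul (H.continuousOn_P t ht).norm)
    exact h1.tendsto.eventually (gt_mem_nhds (by rw [hB]; linarith))
  -- With `|q|² ≤ B` at both times, the two terms of the splitting below are at most `2B` and `4B`
  -- times `|z - y|`.
  have hlim : Tendsto (fun s => 6 * B * ‖U s - U t‖) (𝓝[Ici 0] t) (𝓝 0) := by
    have := (((H.continuousOn_U t ht).tendsto.sub_const (U t)).norm).const_mul (6 * B)
    simpa using this
  refine squeeze_zero' (Eventually.of_forall fun _ => norm_nonneg _) ?_ hlim
  filter_upwards [hev, self_mem_nhdsWithin] with s hsB hs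
  have hs0 : 0 ≤ s := hs
  simp only [hs0, ht, dite_true]
  refine Lp.norm_le_mul_norm_of_ae_le_mul ?_
  filter_upwards [Lp.coeFn_sub (hm s hs0).toLp (hm t ht).toLp, (hm s hs0).coeFn_toLp,
    (hm t ht).coeFn_toLp, H.ae_eq_sub_U hs0 ht, ae_restrict_mem measurableSet_Ioi]
    with x h1 h2 h3 h4 h5
  rw [h1, Pi.sub_apply, h2, h3, ← h4]
  have n1 : ‖q s x‖ ^ 2 ≤ B := (H.norm_q_sq_le hs0 (le_of_lt h5)).trans hsB.le
  have n2 : ‖q t x‖ ^ 2 ≤ B := (H.norm_q_sq_le ht (le_of_lt h5)).trans (by rw [hB]; linarith)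
  set z := q s x
  set y := q t x
  have e : ((‖z‖ : ℂ) ^ 2 + (‖y‖ : ℂ) ^ 2) * (z + y) - ((‖y‖ : ℂ) ^ 2 + (‖y‖ : ℂ) ^ 2) * (y + y) =
      ((‖z‖ ^ 2 + ‖y‖ ^ 2 : ℝ) : ℂ) * (z - y) + (((‖z‖ - ‖y‖) * (‖z‖ + ‖y‖) : ℝ) : ℂ) * (2 * y) := by
    push_cast
    ring
  rw [e]
  refine (norm_add_le _ _).trans ?_
  rw [norm_mul, norm_mul, norm_mul, Complex.norm_real, Complex.norm_real, Real.norm_eq_abs,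
    Real.norm_eq_abs, abs_mul, abs_of_nonneg (by positivity : (0 : ℝ) ≤ ‖z‖ ^ 2 + ‖y‖ ^ 2),
    abs_of_nonneg (by positivity : (0 : ℝ) ≤ ‖z‖ + ‖y‖), Complex.norm_ofNat]
  have h6 := abs_norm_sub_norm_le z y
  have h7 : (‖z‖ + ‖y‖) * (2 * ‖y‖) ≤ 4 * B := by nlinarith [sq_nonneg (‖z‖ - ‖y‖)]
  have h8 : |‖z‖ - ‖y‖| * (‖z‖ + ‖y‖) * (2 * ‖y‖) ≤ ‖z - y‖ * (4 * B) := by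
    rw [mul_assoc]
    exact mul_le_mul h6 h7 (by positivity) (norm_nonneg _)
  nlinarith [norm_nonneg (z - y)]

theorem hasDerivWithinAt_energy_aux (ht : 0 ≤ t) {v : ℝ → ℂ} (hv : v =ᵐ[halfLine] V t) :
    HasDerivWithinAt (fun s => ∫ x, (‖p s x‖ ^ 2 + ‖q s x‖ ^ 4) ∂halfLine)
      ((∫ x, (conj (-(2 * r t x) + 4 * ((‖q t x‖ : ℂ) ^ 2 * q t x)) * v x).re ∂halfLine) -
        2 * (conj (p t 0) * b t).re) (Ici 0) t := by
  obtain ⟨N, hN, hN'⟩ := H.exists_quartic_gradient ht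
  have hG : ∀ s, 0 ≤ s →
      (fun x => -(r s x + r t x) +
        ((‖q s x‖ : ℂ) ^ 2 + (‖q t x‖ : ℂ) ^ 2) * (q s x + q t x)) =ᵐ[halfLine]
      (-(R s + R t) + N s : HalfLineL2) := by
    intro s hs
    filter_upwards [H.ae_eq_R s hs, H.ae_eq_R t ht, hN' s hs, Lp.coeFn_add (R s) (R t),
      Lp.coeFn_neg (R s + R t), Lp.coeFn_add (-(R s + R t)) (N s)] with x h1 h2 h3 h4 h5 h6
    rw [h6, Pi.add_apply, h5, Pi.neg_apply, h4, Pi.add_apply, h1, h2, h3]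
  have iE : ∀ s, 0 ≤ s → Integrable (fun x => ‖p s x‖ ^ 2 + ‖q s x‖ ^ 4) halfLine := fun s hs =>
    (H.isH1_p hs).memLp.integrable_norm_sq.add (H.isH1_q hs).integrable_norm_pow_four
  have key := hasDerivWithinAt_of_sub_eq_inner
    (F := fun s => ∫ x, (‖p s x‖ ^ 2 + ‖q s x‖ ^ 4) ∂halfLine)
    (G := fun s => -(R s + R t) + N s) (b := fun s => q s 0)
    -- This coefficient is the boundary term of the integration by parts; it varies with `s`, whence
    -- the need for continuity of `p(·, 0)`.
    (c := fun s => -(p s 0 + p t 0))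
    (H.hasDerivWithinAt_U t ht)
    (((H.continuousOn_R t ht).add continuousWithinAt_const).neg.add hN)
    (H.hasDerivWithinAt_boundary t ht)
    ((H.continuousOn_p_zero t ht).add continuousWithinAt_const).neg (fun s hs => by
      have hs' : 0 ≤ s := hs
      have hd := (H.isH1_q hs').sub (H.isH1_q ht)
      have ha := (H.isH1_p hs').add (H.isH1_p ht)
      have hA := ha.star.integral_mul_deriv_re hd
      have iA := ha.star.integrable_mul_deriv_re hd
      rw [re_inner_halfLineL2 (hG s hs) (H.ae_eq_sub_U hs ht), ← integral_sub (iE s hs) (iE t ht)]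
      have e : ∀ x, ‖p s x‖ ^ 2 + ‖q s x‖ ^ 4 - (‖p t x‖ ^ 2 + ‖q t x‖ ^ 4) =
          (conj (-(r s x + r t x) +
            ((‖q s x‖ : ℂ) ^ 2 + (‖q t x‖ : ℂ) ^ 2) * (q s x + q t x)) * (q s x - q t x)).re +
          (conj (r s x + r t x) * (q s x - q t x) +
            conj (p s x + p t x) * (p s x - p t x)).re := by
        intro x
        rw [← Complex.mul_conj', ← Complex.mul_conj']
        simp only [show ∀ z : ℂ, ‖z‖ ^ 4 = (‖z‖ ^ 2) ^ 2 by intro z; ring, Complex.sq_norm,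
          Complex.normSq_apply]
        simp
        ring
      have iB : Integrable (fun x => (conj (-(r s x + r t x) +
            ((‖q s x‖ : ℂ) ^ 2 + (‖q t x‖ : ℂ) ^ 2) * (q s x + q t x)) *
              (q s x - q t x)).re) halfLine := by
        have m1 : MemLp (fun x => -(r s x + r t x) +
            ((‖q s x‖ : ℂ) ^ 2 + (‖q t x‖ : ℂ) ^ 2) * (q s x + q t x)) 2 halfLine :=
          (memLp_congr_ae (hG s hs)).2 (Lp.memLp _)
        exact (m1.conj_halfLine.integrable_mul_halfLine hd.memLp).re
      simp_rw [e]
      rw [integral_add iB iA, hA]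
      congr 1
      simp
      ring)
  convert key using 1
  rw [re_inner_halfLineL2 (hG t ht) hv, sub_eq_add_neg]
  congr 1
  · congr 1
    ext x
    congr 3
    ring
  · simp
    ring

theorem continuousOn_energy :
    ContinuousOn (fun s => ∫ x, (‖p s x‖ ^ 2 + ‖q s x‖ ^ 4) ∂halfLine) (Ici 0) := fun _ ht =>
  (H.hasDerivWithinAt_energy_aux ht Filter.EventuallyEq.rfl).continuousWithinAt

theorem hasDerivAt_energy (ht : 0 < t) :
    HasDerivAt (fun s => ∫ x, (‖p s x‖ ^ 2 + ‖q s x‖ ^ 4) ∂halfLine)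
      (-(2 * (conj (p t 0) * b t).re)) t := by
  have h := (H.hasDerivWithinAt_energy_aux ht.le (H.equation t ht)).hasDerivAt (Ici_mem_nhds ht)
  simpa only [re_energy_density_eq_zero, integral_zero, zero_sub] using h

end

end IsRegularSolution

/-! ### From the H² curve to a regular solution -/

theorem IsNLSCurve.exists_isRegularSolution {q₀ Q : ℝ → ℂ} {q : ℝ → ℝ → ℂ} {u : ℝ → HalfLineH2}
    (h : IsNLSCurve q₀ Q q u) (hQ : ContDiffOn ℝ 2 Q (Ici 0)) :
    ∃ (p r : ℝ → ℝ → ℂ) (U P R V : ℝ → HalfLineL2),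
      IsRegularSolution (fun t x => q x t) p r (derivWithin Q (Ici 0)) U P R V := by
  choose p hp1 hp2 using fun t => (u t).2.2.exists_isPrimitive
  choose F hF1 hF2 using fun t => (u t).2.1.exists_isPrimitive
  have hcl : Ici (0 : ℝ) ⊆ closure (interior (Ici 0)) := by rw [interior_Ici, closure_Ioi]
  have hFq : ∀ t, 0 ≤ t → ∀ x, 0 ≤ x → F t x = q x t := by
    intro t ht
    have h1 : F t =ᵐ[volume.restrict (Ici 0)] fun x => q x t := by
      rw [← Measure.restrict_congr_set Ioi_ae_eq_Ici]
      exact (hF2 t).trans (h.represents t ht).symm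
    -- Both sides are continuous up to `x = 0`, so almost everywhere equality extends to the
    -- endpoint and `q(0, t)` is the trace of the H² function.
    exact Measure.eqOn_of_ae_eq h1 (hF1 t).continuousOn (h.continuous_space t ht)
      hcl
  have hU : ∀ t, 0 ≤ t → HasDerivWithinAt (fun t => (u t).toL2)
      (derivWithin (fun s => (u s).toL2) (Ici 0) t) (Ici 0) t := fun t ht =>
    ((h.contDiff_L2.differentiableOn one_ne_zero) t ht).hasDerivWithinAt
  have hQd : ∀ t, 0 ≤ t → HasDerivWithinAt Q (derivWithin Q (Ici 0) t) (Ici 0) t := fun t ht =>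
    ((hQ.differentiableOn two_ne_zero) t ht).hasDerivWithinAt
  have hu : ContinuousOn (fun t => (u t).1) (Ici 0) :=
    continuous_subtype_val.comp_continuousOn h.continuous_H2
  refine ⟨p, fun t => (u t).1.2.2, fun t => (u t).toL2, fun t => (u t).1.2.1, fun t => (u t).1.2.2,
    derivWithin (fun s => (u s).toL2) (Ici 0), ?_⟩
  constructor
  · exact hu.fst
  · exact hu.snd.fst
  · exact hu.snd.snd
  · exact hU
  · exact h.represents
  · exact fun t _ => hp2 t
  · exact fun t _ => Filter.EventuallyEq.rfl
  · exact fun t ht => ((hF1 t).congr_left (hFq t ht)).congr_right (hp2 t).symm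
  · exact fun t _ => hp1 t
  · intro t ht
    filter_upwards [h.equation t ht] with x hx
    rw [nlsField]
    simp only [HalfLineH2.deriv2] at hx
    linear_combination Complex.I * hx -
      derivWithin (fun s => (u s).toL2) (Ici 0) t x * Complex.I_sq
  · intro t ht
    exact (hQd t ht).congr (fun s hs => h.boundary s hs) (h.boundary t ht)
  · exact hQ.continuousOn_derivWithin (uniqueDiffOn_Ici 0) (by norm_num)

/-! ### A priori bounds for mass, energy and boundary flux -/

theorem le_add_integral_of_hasDerivAt_le {F F' φ : ℝ → ℝ} (hF : ContinuousOn F (Ici 0))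
    (hF' : ∀ t, 0 < t → HasDerivAt F (F' t) t) (hφ : ContinuousOn φ (Ici 0))
    (hle : ∀ t, 0 < t → F' t ≤ φ t) {T : ℝ} (hT : 0 ≤ T) :
    F T ≤ F 0 + ∫ t in (0 : ℝ)..T, φ t := by
  have h := intervalIntegral.sub_le_integral_of_hasDeriv_right_of_le hT
    (hF.mono Icc_subset_Ici_self) (fun t ht => (hF' t ht.1).hasDerivWithinAt)
    ((hφ.mono Icc_subset_Ici_self).integrableOn_compact isCompact_Icc) fun t ht => hle t ht.1
  linarith

theorem ContinuousOn.intervalIntegrable_Ici {f : ℝ → ℝ} (hf : ContinuousOn f (Ici 0)) {T : ℝ}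
    (hT : 0 ≤ T) : IntervalIntegrable f volume 0 T :=
  (hf.mono (by rw [uIcc_of_le hT]; exact Icc_subset_Ici_self)).intervalIntegrable

theorem intervalIntegral_le_integral_Ioi {f : ℝ → ℝ} (hf : IntegrableOn f (Ioi 0))
    (h0 : ∀ t, 0 ≤ f t) {T : ℝ} (hT : 0 ≤ T) :
    ∫ t in (0 : ℝ)..T, f t ≤ ∫ t in Ioi (0 : ℝ), f t := by
  rw [intervalIntegral.integral_of_le hT]
  exact setIntegral_mono_set hf (Eventually.of_forall h0)
    (show Ioc 0 T ≤ Ioi 0 from Ioc_subset_Ioi_self).eventuallyLE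

theorem abs_im_conj_mul_le (z y : ℂ) : |(conj z * y).im| ≤ ‖z‖ * ‖y‖ :=
  (Complex.abs_im_le_norm _).trans (by simp)

theorem abs_re_conj_mul_le (z y : ℂ) : |(conj z * y).re| ≤ ‖z‖ * ‖y‖ :=
  (Complex.abs_re_le_norm _).trans (by simp)

namespace IsRegularSolution

variable {q p r : ℝ → ℝ → ℂ} {b : ℝ → ℂ} {U P R V : ℝ → HalfLineL2} {t : ℝ}
  (H : IsRegularSolution q p r b U P R V)
include H

theorem continuousOn_q_zero : ContinuousOn (fun t => q t 0) (Ici 0) := fun t ht =>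
  (H.hasDerivWithinAt_boundary t ht).continuousWithinAt

theorem integrable_energy (ht : 0 ≤ t) :
    Integrable (fun x => ‖p t x‖ ^ 2 + ‖q t x‖ ^ 4) halfLine :=
  (H.isH1_p ht).memLp.integrable_norm_sq.add (H.isH1_q ht).integrable_norm_pow_four

theorem integral_p_sq_le (ht : 0 ≤ t) :
    ∫ x, ‖p t x‖ ^ 2 ∂halfLine ≤ ∫ x, (‖p t x‖ ^ 2 + ‖q t x‖ ^ 4) ∂halfLine :=
  integral_mono (H.isH1_p ht).memLp.integrable_norm_sq (H.integrable_energy ht)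
    fun x => by simp only; linarith [pow_nonneg (norm_nonneg (q t x)) 4]

theorem integral_norm_mul_norm_le_half (ht : 0 ≤ t) :
    ∫ x, ‖q t x‖ * ‖p t x‖ ∂halfLine ≤
      ((∫ x, ‖q t x‖ ^ 2 ∂halfLine) + ∫ x, (‖p t x‖ ^ 2 + ‖q t x‖ ^ 4) ∂halfLine) / 2 := by
  have h1 : ∫ x, ‖q t x‖ * ‖p t x‖ ∂halfLine ≤
      ∫ x, (‖q t x‖ ^ 2 + ‖p t x‖ ^ 2) / 2 ∂halfLine :=
    integral_mono ((H.isH1_q ht).memLp.integrable_norm_mul_norm (H.isH1_p ht).memLp)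
      (((H.isH1_q ht).memLp.integrable_norm_sq.add
        (H.isH1_p ht).memLp.integrable_norm_sq).div_const 2)
      fun x => by simp only; linarith [sq_nonneg (‖q t x‖ - ‖p t x‖)]
  rw [integral_div, integral_add (H.isH1_q ht).memLp.integrable_norm_sq
    (H.isH1_p ht).memLp.integrable_norm_sq] at h1
  linarith [H.integral_p_sq_le ht]

theorem abs_integral_im_le (ht : 0 ≤ t) :
    |∫ x, (conj (q t x) * p t x).im ∂halfLine| ≤
      ((∫ x, ‖q t x‖ ^ 2 ∂halfLine) + ∫ x, (‖p t x‖ ^ 2 + ‖q t x‖ ^ 4) ∂halfLine) / 2 := by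
  refine le_trans ?_ (H.integral_norm_mul_norm_le_half ht)
  exact norm_integral_le_of_norm_le
    ((H.isH1_q ht).memLp.integrable_norm_mul_norm (H.isH1_p ht).memLp)
    (Eventually.of_forall fun x => by
      rw [Real.norm_eq_abs]
      exact abs_im_conj_mul_le _ _)

/-- Mass, energy and the boundary flux `∫ |q_x(0, t)|² dt` stay bounded. -/
theorem exists_bound (h2 : IntegrableOn (fun t => ‖q t 0‖ ^ 2) (Ioi 0))
    (h4 : IntegrableOn (fun t => ‖q t 0‖ ^ 4) (Ioi 0))
    (hb : IntegrableOn (fun t => ‖b t‖ ^ 2) (Ioi 0)) :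
    ∃ C, 0 ≤ C ∧ ∀ T, 0 ≤ T → ∫ x, ‖q T x‖ ^ 2 ∂halfLine ≤ C ∧
      ∫ x, (‖p T x‖ ^ 2 + ‖q T x‖ ^ 4) ∂halfLine ≤ C ∧ ∫ t in (0 : ℝ)..T, ‖p t 0‖ ^ 2 ≤ C := by
  have cA := H.continuousOn_q_zero.norm
  have cg := H.continuousOn_p_zero.norm
  have cb := H.continuousOn_b.norm
  set S2 := ∫ t in Ioi (0 : ℝ), ‖q t 0‖ ^ 2
  set S4 := ∫ t in Ioi (0 : ℝ), ‖q t 0‖ ^ 4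
  set Sb := ∫ t in Ioi (0 : ℝ), ‖b t‖ ^ 2
  have hS2 : 0 ≤ S2 := setIntegral_nonneg measurableSet_Ioi fun _ _ => by positivity
  have hS4 : 0 ≤ S4 := setIntegral_nonneg measurableSet_Ioi fun _ _ => by positivity
  have hSb : 0 ≤ Sb := setIntegral_nonneg measurableSet_Ioi fun _ _ => by positivity
  set m : ℝ → ℝ := fun t => ∫ x, ‖q t x‖ ^ 2 ∂halfLine with hm
  set k : ℝ → ℝ := fun t => ∫ x, (‖p t x‖ ^ 2 + ‖q t x‖ ^ 4) ∂halfLine with hk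
  set y : ℝ → ℝ := fun t => ∫ x, (conj (q t x) * p t x).im ∂halfLine with hy
  have m0 : 0 ≤ m 0 := integral_nonneg fun _ => by positivity
  have k0 : 0 ≤ k 0 := integral_nonneg fun _ => by positivity
  -- Young's inequality is weighted so that mass and energy each pay half of the flux `∫|p(0)|²`.
  have main : ∀ T, 0 ≤ T → m T ≤ m 0 + 2 * S2 + (∫ t in (0 : ℝ)..T, ‖p t 0‖ ^ 2) / 2 ∧
      k T ≤ k 0 + 2 * Sb + (∫ t in (0 : ℝ)..T, ‖p t 0‖ ^ 2) / 2 ∧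
      ∫ t in (0 : ℝ)..T, ‖p t 0‖ ^ 2 ≤ y T - y 0 + S4 + (S2 + Sb) / 2 := by
    intro T hT
    have ig : IntervalIntegrable (fun t => ‖p t 0‖ ^ 2) volume 0 T :=
      (cg.pow 2).intervalIntegrable_Ici hT
    have iA2 : IntervalIntegrable (fun t => ‖q t 0‖ ^ 2) volume 0 T :=
      (cA.pow 2).intervalIntegrable_Ici hT
    have iA4 : IntervalIntegrable (fun t => ‖q t 0‖ ^ 4) volume 0 T :=
      (cA.pow 4).intervalIntegrable_Ici hT
    have ib : IntervalIntegrable (fun t => ‖b t‖ ^ 2) volume 0 T :=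
      (cb.pow 2).intervalIntegrable_Ici hT
    have l2 := intervalIntegral_le_integral_Ioi h2 (fun t => by positivity) hT
    have l4 := intervalIntegral_le_integral_Ioi h4 (fun t => by positivity) hT
    have lb := intervalIntegral_le_integral_Ioi hb (fun t => by positivity) hT
    refine ⟨?_, ?_, ?_⟩
    · have h := le_add_integral_of_hasDerivAt_le (F := m)
        (F' := fun t => 2 * (conj (q t 0) * p t 0).im)
        (φ := fun t => 2 * ‖q t 0‖ ^ 2 + ‖p t 0‖ ^ 2 / 2)
        (by simpa using H.continuousOn_mass IsWeight.one)
        (fun t ht => by simpa using H.hasDerivAt_mass IsWeight.one ht)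
        ((continuousOn_const.mul (cA.pow 2)).add ((cg.pow 2).div_const 2))
        (fun t _ => by
          have := (abs_le.1 (abs_im_conj_mul_le (q t 0) (p t 0))).2
          nlinarith [sq_nonneg (2 * ‖q t 0‖ - ‖p t 0‖)]) hT
      rw [intervalIntegral.integral_add (iA2.const_mul 2) (ig.div_const 2),
        intervalIntegral.integral_const_mul, intervalIntegral.integral_div] at h
      linarith
    · have h := le_add_integral_of_hasDerivAt_le (F := k)
        (F' := fun t => -(2 * (conj (p t 0) * b t).re))
        (φ := fun t => 2 * ‖b t‖ ^ 2 + ‖p t 0‖ ^ 2 / 2)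
        H.continuousOn_energy (fun t ht => H.hasDerivAt_energy ht)
        ((continuousOn_const.mul (cb.pow 2)).add ((cg.pow 2).div_const 2))
        (fun t _ => by
          have := (abs_le.1 (abs_re_conj_mul_le (p t 0) (b t))).1
          nlinarith [sq_nonneg (2 * ‖b t‖ - ‖p t 0‖)]) hT
      rw [intervalIntegral.integral_add (ib.const_mul 2) (ig.div_const 2),
        intervalIntegral.integral_const_mul, intervalIntegral.integral_div] at h
      linarith
    · have h := le_add_integral_of_hasDerivAt_le (F := fun t => -y t)
        (F' := fun t => -(‖p t 0‖ ^ 2 - ‖q t 0‖ ^ 4 - (conj (q t 0) * b t).im))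
        (φ := fun t => ‖q t 0‖ ^ 4 + (‖q t 0‖ ^ 2 + ‖b t‖ ^ 2) / 2 - ‖p t 0‖ ^ 2)
        (by
          have c := H.continuousOn_momentum IsWeight.one
          simp only [one_mul] at c
          exact c.neg)
        (fun t ht => by
          have d := H.hasDerivAt_momentum IsWeight.one ht
          simp only [one_mul, zero_mul, add_zero, integral_zero, zero_add] at d
          exact d.neg)
        (((cA.pow 4).add (((cA.pow 2).add (cb.pow 2)).div_const 2)).sub (cg.pow 2))
        (fun t _ => by
          have := (abs_le.1 (abs_im_conj_mul_le (q t 0) (b t))).2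
          nlinarith [sq_nonneg (‖q t 0‖ - ‖b t‖)]) hT
      rw [intervalIntegral.integral_sub (iA4.add ((iA2.add ib).div_const 2)) ig,
        intervalIntegral.integral_add iA4 ((iA2.add ib).div_const 2),
        intervalIntegral.integral_div, intervalIntegral.integral_add iA2 ib] at h
      linarith
  -- Since `y T ≤ (m T + k T) / 2`, the flux reappears on the right with total factor `1/2` and is
  -- absorbed; the factor 4 is a generous common bound.
  refine ⟨4 * (m 0 + k 0 + S2 + S4 + Sb + |y 0|), by positivity, fun T hT => ?_⟩
  obtain ⟨a1, a2, a3⟩ := main T hT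
  have a4 := (abs_le.1 (H.abs_integral_im_le hT)).2
  have a5 : y T ≤ (m T + k T) / 2 := a4
  have a6 := neg_abs_le (y 0)
  have a7 := abs_nonneg (y 0)
  refine ⟨show m T ≤ _ from ?_, show k T ≤ _ from ?_, ?_⟩ <;> linarith

end IsRegularSolution

/-! ### Truncated weights and the pseudo-conformal functional -/

theorem MeasureTheory.Integrable.continuous_mul_halfLine {g v : ℝ → ℝ} {C : ℝ}
    (hg : Integrable g halfLine) (hv : Continuous v) (hC : ∀ x, 0 ≤ x → |v x| ≤ C) :
    Integrable (fun x => v x * g x) halfLine :=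
  hg.bdd_mul hv.aestronglyMeasurable (c := C)
    ((ae_restrict_iff' measurableSet_Ioi).2 (Eventually.of_forall fun x hx => hC x (le_of_lt hx)))

/-- A bounded concave replacement `a` of the weight `x`, with derivatives `a₁`, `a₂`. -/
structure IsCutoff (a a₁ a₂ : ℝ → ℝ) (ε : ℝ) : Prop extends IsWeight a a₁ a₂ where
  zero : a 0 = 0
  deriv_zero : a₁ 0 = 1
  nonneg : ∀ x, 0 ≤ x → 0 ≤ a x
  le_self : ∀ x, 0 ≤ x → a x ≤ x
  deriv_nonneg : ∀ x, 0 ≤ a₁ x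
  deriv_le_one : ∀ x, a₁ x ≤ 1
  abs_deriv2_le : ∀ x, |a₂ x| ≤ ε

namespace IsWeight

variable {w w₁ w₂ : ℝ → ℝ}

theorem integrable_mul (hw : IsWeight w w₁ w₂) {g : ℝ → ℝ} (hg : Integrable g halfLine) :
    Integrable (fun x => w x * g x) halfLine := by
  obtain ⟨C, hC⟩ := hw.bounded
  exact hg.continuous_mul_halfLine hw.continuous_weight fun x hx => (hC x hx).1

theorem integrable_deriv_mul (hw : IsWeight w w₁ w₂) {g : ℝ → ℝ} (hg : Integrable g halfLine) :
    Integrable (fun x => w₁ x * g x) halfLine := by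
  obtain ⟨C, hC⟩ := hw.bounded
  exact hg.continuous_mul_halfLine hw.continuous_deriv fun x hx => (hC x hx).2.1

theorem integrable_deriv2_mul (hw : IsWeight w w₁ w₂) {g : ℝ → ℝ} (hg : Integrable g halfLine) :
    Integrable (fun x => w₂ x * g x) halfLine := by
  obtain ⟨C, hC⟩ := hw.bounded
  exact hg.continuous_mul_halfLine hw.continuous fun x hx => (hC x hx).2.2

theorem sq (hw : IsWeight w w₁ w₂) :
    IsWeight (fun x => w x ^ 2) (fun x => 2 * (w x * w₁ x))
      (fun x => 2 * (w₁ x * w₁ x + w x * w₂ x)) := by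
  refine ⟨fun x => ?_, fun x => ?_, ?_, ?_⟩
  · refine ((hw.hasDerivAt x).pow 2).congr_deriv ?_
    simp
    ring
  · exact ((hw.hasDerivAt x).mul (hw.hasDerivAt' x)).const_mul 2
  · have h1 := hw.continuous_weight
    have h2 := hw.continuous_deriv
    have h3 := hw.continuous
    fun_prop
  · obtain ⟨C, hC⟩ := hw.bounded
    refine ⟨4 * C ^ 2, fun x hx => ?_⟩
    obtain ⟨b0, b1, b2⟩ := hC x hx
    have hC0 : 0 ≤ C := (abs_nonneg _).trans b0
    have e0 : |w x| * |w x| ≤ C * C := mul_le_mul b0 b0 (abs_nonneg _) hC0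
    have e1 : |w x| * |w₁ x| ≤ C * C := mul_le_mul b0 b1 (abs_nonneg _) hC0
    have e2 : |w₁ x| * |w₁ x| ≤ C * C := mul_le_mul b1 b1 (abs_nonneg _) hC0
    have e3 : |w x| * |w₂ x| ≤ C * C := mul_le_mul b0 b2 (abs_nonneg _) hC0
    refine ⟨?_, ?_, ?_⟩
    · rw [pow_two, abs_mul]
      nlinarith
    · rw [abs_mul, abs_mul, abs_two]
      nlinarith
    · have := abs_add_le (w₁ x * w₁ x) (w x * w₂ x)
      rw [abs_mul, abs_mul] at this
      rw [abs_mul, abs_two]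
      nlinarith

end IsWeight

/-- After cancellation, the left side is the error `4s((1 - a₁)(p² + q⁴) - a₂K)` minus `s⁻¹` times
`a²q² - 4s a a₁ I + 4s² a₁ p²`. The latter is nonnegative: it dominates `(aq - 2s a₁ p)² + 4s² a₁(1
- a₁) p²`. -/
theorem cutoff_pointwise_le {a a₁ a₂ ε s q p I K : ℝ} (hs : 0 < s) (ha : 0 ≤ a) (h0 : 0 ≤ a₁)
    (h1 : a₁ ≤ 1) (h2 : |a₂| ≤ ε) (hq : 0 ≤ q) (hp : 0 ≤ p) (hI : |I| ≤ q * p)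
    (hK : |K| ≤ q * p) :
    2 * (2 * (a * a₁) * I) - 4 * (a * I) - 4 * s * (a₁ * (2 * p ^ 2 + q ^ 4) + a₂ * K) +
        8 * s * (p ^ 2 + q ^ 4) -
        1 / s * (a ^ 2 * q ^ 2 - 4 * s * (a * I) + 4 * s ^ 2 * (p ^ 2 + q ^ 4)) ≤
      4 * s * ((1 - a₁) * (p ^ 2 + q ^ 4) + ε * (q * p)) := by
  have hqp : 0 ≤ q * p := mul_nonneg hq hp
  have k1 : -(a₂ * K) ≤ ε * (q * p) := by
    refine (neg_le_abs _).trans ?_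
    rw [abs_mul]
    exact mul_le_mul h2 hK (abs_nonneg _) ((abs_nonneg _).trans h2)
  have k2 : a₁ * a * I ≤ a₁ * a * (q * p) :=
    mul_le_mul_of_nonneg_left ((le_abs_self _).trans hI) (mul_nonneg h0 ha)
  have k3 : 0 ≤ a ^ 2 * q ^ 2 - 4 * s * a₁ * a * I + 4 * s ^ 2 * a₁ * p ^ 2 := by
    have t1 : 0 ≤ s ^ 2 * p ^ 2 * (a₁ * (1 - a₁)) := by
      have : 0 ≤ 1 - a₁ := by linarith
      positivity
    have t2 := mul_le_mul_of_nonneg_left k2 hs.le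
    nlinarith [sq_nonneg (a * q - 2 * s * a₁ * p)]
  have k4 : 0 ≤ 1 / s * (a ^ 2 * q ^ 2 - 4 * s * a₁ * a * I + 4 * s ^ 2 * a₁ * p ^ 2) :=
    mul_nonneg (by positivity) k3
  have k5 : 4 * s * (-(a₂ * K)) ≤ 4 * s * (ε * (q * p)) :=
    mul_le_mul_of_nonneg_left k1 (by positivity)
  have e1 : 1 / s * (a ^ 2 * q ^ 2 - 4 * s * a₁ * a * I + 4 * s ^ 2 * a₁ * p ^ 2) =
      a ^ 2 * q ^ 2 / s - 4 * a₁ * a * I + 4 * s * a₁ * p ^ 2 := by field_simp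
  have e2 : 1 / s * (a ^ 2 * q ^ 2 - 4 * s * (a * I) + 4 * s ^ 2 * (p ^ 2 + q ^ 4)) =
      a ^ 2 * q ^ 2 / s - 4 * (a * I) + 4 * s * (p ^ 2 + q ^ 4) := by field_simp
  rw [e1] at k4
  rw [e2]
  nlinarith

/-- Quotient rule for `N/s` with `s' = 1`: the term `-N/s²` is what compensates the growth `N/s` of
the functional. Here `r₁`, `r₂` are the boundary terms. -/
theorem quotient_deriv_le {X N s r₁ r₂ φ : ℝ} (hs : 0 < s)
    (h : X - 1 / s * N - 4 * s * r₁ - 8 * s ^ 2 * r₂ ≤ s * φ) :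
    ((X - 4 * s * r₁ - 8 * s ^ 2 * r₂) * s - N) / s ^ 2 ≤ φ := by
  have e : ((X - 4 * s * r₁ - 8 * s ^ 2 * r₂) * s - N) / s ^ 2 =
      (X - 1 / s * N - 4 * s * r₁ - 8 * s ^ 2 * r₂) / s := by
    field_simp
    ring
  rw [e, div_le_iff₀ hs]
  linarith

namespace IsRegularSolution

variable {q p r : ℝ → ℝ → ℂ} {b : ℝ → ℂ} {U P R V : ℝ → HalfLineL2} {t : ℝ}

theorem continuousOn_integral_mul_norm_sq {f : ℝ → ℝ → ℂ} {F : ℝ → HalfLineL2}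
    (hF : ContinuousOn F (Ici 0)) (hf : ∀ t, 0 ≤ t → f t =ᵐ[halfLine] F t) {w : ℝ → ℝ} {C : ℝ}
    (hw : Continuous w) (hC : ∀ x, 0 ≤ x → |w x| ≤ C) :
    ContinuousOn (fun t => ∫ x, w x * ‖f t x‖ ^ 2 ∂halfLine) (Ici 0) := by
  obtain ⟨T, hT⟩ := exists_weight_mul_clm hw hC
  have h1 : ContinuousOn (fun t => (inner ℂ (T (F t)) (F t)).re) (Ici 0) :=
    Complex.continuous_re.comp_continuousOn (ContinuousOn.inner (𝕜 := ℂ) (T.continuous.comp_continuousOn hF) hF)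
  refine h1.congr fun t ht => ?_
  simp only
  rw [re_inner_halfLineL2 (hT _ _ (hf t ht)) (hf t ht)]
  congr 1
  ext x
  simp only [Complex.sq_norm, Complex.normSq_apply]
  simp
  ring

/-- The truncated pseudo-conformal functional `∫ |a q + 2 i s q_x|² + 4 s² ∫ |q|⁴`, expanded, with
`s = 1 + t`. -/
noncomputable def pseudoconformal (a : ℝ → ℝ) (q p : ℝ → ℝ → ℂ) (t : ℝ) : ℝ :=
  (∫ x, a x ^ 2 * ‖q t x‖ ^ 2 ∂halfLine) -
    4 * (1 + t) * (∫ x, a x * (conj (q t x) * p t x).im ∂halfLine) +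
    4 * (1 + t) ^ 2 * ∫ x, (‖p t x‖ ^ 2 + ‖q t x‖ ^ 4) ∂halfLine

variable (H : IsRegularSolution q p r b U P R V) {a a₁ a₂ : ℝ → ℝ} {ε : ℝ}
include H

theorem integrable_im (ht : 0 ≤ t) : Integrable (fun x => (conj (q t x) * p t x).im) halfLine :=
  ((H.isH1_q ht).star.memLp.integrable_mul_halfLine (H.isH1_p ht).memLp).im

theorem integrable_re (ht : 0 ≤ t) : Integrable (fun x => (conj (q t x) * p t x).re) halfLine :=
  ((H.isH1_q ht).star.memLp.integrable_mul_halfLine (H.isH1_p ht).memLp).re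

theorem integrable_momentum_density (ht : 0 ≤ t) (ha : IsWeight a a₁ a₂) :
    Integrable (fun x => a₁ x * (2 * ‖p t x‖ ^ 2 + ‖q t x‖ ^ 4) +
      a₂ x * (conj (q t x) * p t x).re) halfLine :=
  (ha.integrable_deriv_mul (((H.isH1_p ht).memLp.integrable_norm_sq.const_mul 2).add
    (H.isH1_q ht).integrable_norm_pow_four)).add (ha.integrable_deriv2_mul (H.integrable_re ht))

theorem integrable_pseudoconformal_density (ht : 0 ≤ t) (ha : IsWeight a a₁ a₂) (s : ℝ) :
    Integrable (fun x => a x ^ 2 * ‖q t x‖ ^ 2 - 4 * s * (a x * (conj (q t x) * p t x).im) +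
      4 * s ^ 2 * (‖p t x‖ ^ 2 + ‖q t x‖ ^ 4)) halfLine :=
  ((ha.sq.integrable_mul (H.isH1_q ht).memLp.integrable_norm_sq).sub
    ((ha.integrable_mul (H.integrable_im ht)).const_mul _)).add
    ((H.integrable_energy ht).const_mul _)

theorem pseudoconformal_eq_integral (ht : 0 ≤ t) (ha : IsWeight a a₁ a₂) :
    pseudoconformal a q p t =
      ∫ x, (a x ^ 2 * ‖q t x‖ ^ 2 - 4 * (1 + t) * (a x * (conj (q t x) * p t x).im) +
        4 * (1 + t) ^ 2 * (‖p t x‖ ^ 2 + ‖q t x‖ ^ 4)) ∂halfLine := by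
  have i1 := ha.sq.integrable_mul (H.isH1_q ht).memLp.integrable_norm_sq
  have i2 := (ha.integrable_mul (H.integrable_im ht)).const_mul (4 * (1 + t))
  have i3 := (H.integrable_energy ht).const_mul (4 * (1 + t) ^ 2)
  rw [integral_add (by exact i1.sub i2) i3, integral_sub i1 i2, integral_const_mul,
    integral_const_mul, pseudoconformal]

theorem pseudoconformal_flux_le (ht : 0 ≤ t) (ha : IsCutoff a a₁ a₂ ε) :
    2 * (∫ x, 2 * (a x * a₁ x) * (conj (q t x) * p t x).im ∂halfLine) -
        4 * (∫ x, a x * (conj (q t x) * p t x).im ∂halfLine) -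
        4 * (1 + t) * (∫ x, (a₁ x * (2 * ‖p t x‖ ^ 2 + ‖q t x‖ ^ 4) +
          a₂ x * (conj (q t x) * p t x).re) ∂halfLine) +
        8 * (1 + t) * (∫ x, (‖p t x‖ ^ 2 + ‖q t x‖ ^ 4) ∂halfLine) -
        1 / (1 + t) * pseudoconformal a q p t ≤
      4 * (1 + t) * ((∫ x, (1 - a₁ x) * (‖p t x‖ ^ 2 + ‖q t x‖ ^ 4) ∂halfLine) +
        ε * ∫ x, ‖q t x‖ * ‖p t x‖ ∂halfLine) := by
  have hw := ha.toIsWeight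
  have hs : 0 < 1 + t := by linarith
  have i1 := (hw.sq.integrable_deriv_mul (H.integrable_im ht)).const_mul 2
  have i2 := (hw.integrable_mul (H.integrable_im ht)).const_mul 4
  have i3 := (H.integrable_momentum_density ht hw).const_mul (4 * (1 + t))
  have i4 := (H.integrable_energy ht).const_mul (8 * (1 + t))
  have i5 := (H.integrable_pseudoconformal_density ht hw (1 + t)).const_mul (1 / (1 + t))
  have i6 : Integrable (fun x => (1 - a₁ x) * (‖p t x‖ ^ 2 + ‖q t x‖ ^ 4)) halfLine :=
    (H.integrable_energy ht).continuous_mul_halfLine (C := 1)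
      (continuous_const.sub hw.continuous_deriv) fun x _ => by
        rw [abs_of_nonneg (by linarith [ha.deriv_le_one x])]
        linarith [ha.deriv_nonneg x]
  have i7 := ((H.isH1_q ht).memLp.integrable_norm_mul_norm (H.isH1_p ht).memLp).const_mul ε
  rw [H.pseudoconformal_eq_integral ht hw, ← integral_const_mul, ← integral_const_mul,
    ← integral_const_mul, ← integral_const_mul, ← integral_const_mul, ← integral_const_mul,
    ← integral_add i6 i7, ← integral_const_mul, ← integral_sub i1 i2,
    ← integral_sub (by exact i1.sub i2) i3, ← integral_add (by exact (i1.sub i2).sub i3) i4,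
    ← integral_sub (by exact ((i1.sub i2).sub i3).add i4) i5]
  refine integral_mono_ae ((((i1.sub i2).sub i3).add i4).sub i5)
    ((i6.add i7).const_mul _) ?_
  refine (ae_restrict_iff' measurableSet_Ioi).2 (Eventually.of_forall fun x hx => ?_)
  exact cutoff_pointwise_le hs (ha.nonneg x (le_of_lt hx)) (ha.deriv_nonneg x) (ha.deriv_le_one x)
    (ha.abs_deriv2_le x) (norm_nonneg _) (norm_nonneg _) (abs_im_conj_mul_le _ _)
    (abs_re_conj_mul_le _ _)

/-- As `a 0 = 0`, the mass boundary term disappears, and of the momentum ones only that carrying `a₁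
0 = 1` survives. -/
theorem hasDerivAt_pseudoconformal (ht : 0 < t) (ha : IsCutoff a a₁ a₂ ε) :
    HasDerivAt (fun t => pseudoconformal a q p t)
      (2 * (∫ x, 2 * (a x * a₁ x) * (conj (q t x) * p t x).im ∂halfLine) -
        4 * (∫ x, a x * (conj (q t x) * p t x).im ∂halfLine) -
        4 * (1 + t) * (∫ x, (a₁ x * (2 * ‖p t x‖ ^ 2 + ‖q t x‖ ^ 4) +
          a₂ x * (conj (q t x) * p t x).re) ∂halfLine) +
        8 * (1 + t) * (∫ x, (‖p t x‖ ^ 2 + ‖q t x‖ ^ 4) ∂halfLine) -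
        4 * (1 + t) * (conj (q t 0) * p t 0).re -
        8 * (1 + t) ^ 2 * (conj (p t 0) * b t).re) t := by
  have hw := ha.toIsWeight
  have hs : HasDerivAt (fun t : ℝ => 1 + t) 1 t := (hasDerivAt_id t).const_add 1
  have d1 := H.hasDerivAt_mass hw.sq ht
  have d2 := (hs.const_mul 4).mul (H.hasDerivAt_momentum hw ht)
  have d3 := ((hs.pow 2).const_mul 4).mul (H.hasDerivAt_energy ht)
  refine ((d1.sub d2).add d3).congr_deriv ?_
  simp only [ha.zero, ha.deriv_zero, Pi.pow_apply]
  push_cast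
  ring

theorem continuousOn_pseudoconformal (ha : IsCutoff a a₁ a₂ ε) :
    ContinuousOn (fun t => pseudoconformal a q p t) (Ici 0) := by
  have c1 := H.continuousOn_mass ha.toIsWeight.sq
  have c2 := H.continuousOn_momentum ha.toIsWeight
  have c3 := H.continuousOn_energy
  unfold pseudoconformal
  fun_prop

/-- The pseudo-conformal functional grows at most linearly, up to the truncation error. -/
theorem pseudoconformal_le (ha : IsCutoff a a₁ a₂ ε) (hε : 0 ≤ ε) {C : ℝ}
    (hm : ∀ t, 0 ≤ t → ∫ x, ‖q t x‖ ^ 2 ∂halfLine ≤ C)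
    (hk : ∀ t, 0 ≤ t → ∫ x, (‖p t x‖ ^ 2 + ‖q t x‖ ^ 4) ∂halfLine ≤ C)
    (hg : ∀ T, 0 ≤ T → ∫ t in (0 : ℝ)..T, ‖p t 0‖ ^ 2 ≤ C)
    (h2 : IntegrableOn (fun t => ‖q t 0‖ ^ 2) (Ioi 0))
    (hb : IntegrableOn (fun t => ((1 + t) * ‖b t‖) ^ 2) (Ioi 0)) {T : ℝ} (hT : 0 ≤ T) :
    pseudoconformal a q p T ≤ (1 + T) * (pseudoconformal a q p 0 +
      2 * (∫ t in Ioi (0 : ℝ), ‖q t 0‖ ^ 2) + 4 * (∫ t in Ioi (0 : ℝ), ((1 + t) * ‖b t‖) ^ 2) +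
      6 * C + 4 * (∫ t in (0 : ℝ)..T, ((∫ x, (1 - a₁ x) * ‖p t x‖ ^ 2 ∂halfLine) +
        2 * C * ∫ x, (1 - a₁ x) * ‖q t x‖ ^ 2 ∂halfLine)) + 4 * ε * C * T) := by
  have hw := ha.toIsWeight
  have cθ : Continuous fun x => 1 - a₁ x := continuous_const.sub hw.continuous_deriv
  have bθ : ∀ x, 0 ≤ x → |1 - a₁ x| ≤ 1 := fun x _ => by
    rw [abs_of_nonneg (by linarith [ha.deriv_le_one x])]
    linarith [ha.deriv_nonneg x]
  have cA : ContinuousOn (fun t => ‖q t 0‖ ^ 2) (Ici 0) := H.continuousOn_q_zero.norm.pow 2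
  have cg : ContinuousOn (fun t => ‖p t 0‖ ^ 2) (Ici 0) := H.continuousOn_p_zero.norm.pow 2
  have cb : ContinuousOn (fun t => ((1 + t) * ‖b t‖) ^ 2) (Ici 0) :=
    ((continuousOn_const.add continuousOn_id).mul H.continuousOn_b.norm).pow 2
  have cδ : ContinuousOn (fun t => (∫ x, (1 - a₁ x) * ‖p t x‖ ^ 2 ∂halfLine) +
        2 * C * ∫ x, (1 - a₁ x) * ‖q t x‖ ^ 2 ∂halfLine) (Ici 0) :=
    (continuousOn_integral_mul_norm_sq H.continuousOn_P H.ae_eq_P cθ bθ).add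
      (continuousOn_const.mul (continuousOn_integral_mul_norm_sq H.continuousOn_U H.ae_eq_U cθ bθ))
  have hs1 : ContinuousOn (fun t : ℝ => 1 + t) (Ici 0) := continuousOn_const.add continuousOn_id
  have main := le_add_integral_of_hasDerivAt_le (F := fun t => pseudoconformal a q p t / (1 + t))
    (φ := fun t => 2 * ‖q t 0‖ ^ 2 + 4 * ((1 + t) * ‖b t‖) ^ 2 + 6 * ‖p t 0‖ ^ 2 +
      4 * ((∫ x, (1 - a₁ x) * ‖p t x‖ ^ 2 ∂halfLine) +
        2 * C * ∫ x, (1 - a₁ x) * ‖q t x‖ ^ 2 ∂halfLine) + 4 * ε * C)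
    ((H.continuousOn_pseudoconformal ha).div hs1 fun t ht => by
      have : 0 ≤ t := ht
      positivity)
    (fun t ht => (H.hasDerivAt_pseudoconformal ht ha).div ((hasDerivAt_id t).const_add 1)
      (by positivity))
    (((((continuousOn_const.mul cA).add (continuousOn_const.mul cb)).add
      (continuousOn_const.mul cg)).add (continuousOn_const.mul cδ)).add continuousOn_const)
    (fun t ht => by
      have hs : 0 < 1 + t := by linarith
      have f1 := H.pseudoconformal_flux_le ht.le ha
      have f2 : ∫ x, (1 - a₁ x) * (‖p t x‖ ^ 2 + ‖q t x‖ ^ 4) ∂halfLine ≤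
          (∫ x, (1 - a₁ x) * ‖p t x‖ ^ 2 ∂halfLine) +
            2 * C * ∫ x, (1 - a₁ x) * ‖q t x‖ ^ 2 ∂halfLine := by
        have j1 := (H.isH1_p ht.le).memLp.integrable_norm_sq.continuous_mul_halfLine cθ bθ
        have j2 := (H.isH1_q ht.le).memLp.integrable_norm_sq.continuous_mul_halfLine cθ bθ
        rw [← integral_const_mul, ← integral_add j1 (j2.const_mul _)]
        refine integral_mono_ae ((H.integrable_energy ht.le).continuous_mul_halfLine cθ bθ)
          (j1.add (j2.const_mul _)) ?_
        refine (ae_restrict_iff' measurableSet_Ioi).2 (Eventually.of_forall fun x hx => ?_)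
        have n1 := H.norm_q_sq_le ht.le (le_of_lt hx)
        have n2 := norm_sq_halfLineL2 (H.ae_eq_U t ht.le)
        have n3 := norm_sq_halfLineL2 (H.ae_eq_P t ht.le)
        -- The sup bound turns the quartic error into a quadratic one, whose weighted integral is
        -- continuous in time by `continuousOn_integral_mul_norm_sq`.
        have n4 : ‖q t x‖ ^ 2 ≤ 2 * C := by
          nlinarith [sq_nonneg (‖U t‖ - ‖P t‖), hm t ht.le, hk t ht.le, H.integral_p_sq_le ht.le]
        have n5 : 0 ≤ 1 - a₁ x := by linarith [ha.deriv_le_one x]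
        have n6 : ‖q t x‖ ^ 4 ≤ 2 * C * ‖q t x‖ ^ 2 := by
          nlinarith [mul_le_mul_of_nonneg_right n4 (sq_nonneg ‖q t x‖)]
        have n7 := mul_le_mul_of_nonneg_left n6 n5
        simp only
        linarith
      have f3 : ε * ∫ x, ‖q t x‖ * ‖p t x‖ ∂halfLine ≤ ε * C := by
        refine mul_le_mul_of_nonneg_left ?_ hε
        linarith [H.integral_norm_mul_norm_le_half ht.le, hm t ht.le, hk t ht.le]
      have f4 := (abs_le.1 (abs_re_conj_mul_le (q t 0) (p t 0))).1
      have f5 := (abs_le.1 (abs_re_conj_mul_le (p t 0) (b t))).1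
      have f6 := mul_le_mul_of_nonneg_left (add_le_add f2 f3) (by positivity : 0 ≤ 4 * (1 + t))
      -- After division by `1 + t`, the boundary terms cost `2|p(0)|²` here and `4|p(0)|²` in `g2`:
      -- this is the source of `6 C`.
      have g1 : -(4 * (1 + t) * (conj (q t 0) * p t 0).re) ≤
          (1 + t) * (2 * ‖q t 0‖ ^ 2 + 2 * ‖p t 0‖ ^ 2) := by
        nlinarith [sq_nonneg (‖q t 0‖ - ‖p t 0‖)]
      have g2 : -(8 * (1 + t) * (conj (p t 0) * b t).re) ≤
          4 * ((1 + t) * ‖b t‖) ^ 2 + 4 * ‖p t 0‖ ^ 2 := by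
        nlinarith [sq_nonneg ((1 + t) * ‖b t‖ - ‖p t 0‖)]
      have g3 := mul_le_mul_of_nonneg_left g2 hs.le
      simp only [mul_one]
      refine quotient_deriv_le hs ?_
      nlinarith) hT
  have iA := (cA.intervalIntegrable_Ici hT).const_mul 2
  have ib := (cb.intervalIntegrable_Ici hT).const_mul 4
  have ig := (cg.intervalIntegrable_Ici hT).const_mul 6
  have iδ := (cδ.intervalIntegrable_Ici hT).const_mul 4
  have l2 := intervalIntegral_le_integral_Ioi h2 (fun t => by positivity) hT
  have lb := intervalIntegral_le_integral_Ioi hb (fun t => by positivity) hT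
  have lg := hg T hT
  rw [intervalIntegral.integral_add (((iA.add ib).add ig).add iδ) intervalIntegrable_const,
    intervalIntegral.integral_add ((iA.add ib).add ig) iδ,
    intervalIntegral.integral_add (iA.add ib) ig, intervalIntegral.integral_add iA ib,
    intervalIntegral.integral_const_mul, intervalIntegral.integral_const_mul,
    intervalIntegral.integral_const_mul, intervalIntegral.integral_const_mul,
    intervalIntegral.integral_const, add_zero, div_one,
    div_le_iff₀ (by positivity), smul_eq_mul, sub_zero] at main
  rw [mul_comm (1 + T)]
  refine main.trans (mul_le_mul_of_nonneg_right ?_ (by positivity))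
  linarith

end IsRegularSolution

/-! ### Removal of the truncation and the decay estimate -/

theorem Real.arctan_le_self_of_nonneg {y : ℝ} (hy : 0 ≤ y) : Real.arctan y ≤ y := by
  have h0 := Real.arctan_nonneg.2 hy
  have h := Real.le_tan h0 (Real.arctan_lt_pi_div_two y)
  rwa [Real.tan_arctan] at h

/-- This choice has slope tending to 1 pointwise as `R → ∞` and curvature at most `1/R`, so both
truncation errors vanish in the limit. -/
theorem isCutoff_arctan {R : ℝ} (hR : 0 < R) :
    IsCutoff (fun x => R * Real.arctan (x / R)) (fun x => 1 / (1 + (x / R) ^ 2))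
      (fun x => -(2 * (x / R) * (1 / R)) / (1 + (x / R) ^ 2) ^ 2) (1 / R) := by
  have hd : ∀ x, HasDerivAt (fun x => x / R) (1 / R) x := fun x => (hasDerivAt_id x).div_const R
  have h1 : ∀ y : ℝ, 0 < 1 + y ^ 2 := fun y => by positivity
  have hb2 : ∀ x, |-(2 * (x / R) * (1 / R)) / (1 + (x / R) ^ 2) ^ 2| ≤ 1 / R := by
    intro x
    set y := x / R
    have hden : 0 < (1 + y ^ 2) ^ 2 := pow_pos (h1 y) 2
    rw [abs_div, abs_of_pos hden, div_le_iff₀ hden, abs_neg, abs_mul,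
      abs_of_pos (one_div_pos.2 hR), mul_comm]
    refine mul_le_mul_of_nonneg_left ?_ (one_div_pos.2 hR).le
    rw [abs_le]
    constructor <;> nlinarith [sq_nonneg (y - 1), sq_nonneg (y + 1), sq_nonneg (y ^ 2), sq_nonneg y]
  have hb1 : ∀ x : ℝ, 1 / (1 + (x / R) ^ 2) ≤ 1 := fun x => by
    rw [div_le_one (h1 _)]
    nlinarith [sq_nonneg (x / R)]
  have hb1' : ∀ x : ℝ, 0 ≤ 1 / (1 + (x / R) ^ 2) := fun x => (one_div_pos.2 (h1 _)).le
  refine ⟨⟨fun x => ?_, fun x => ?_, ?_, R * (Real.pi / 2) + 1 + 1 / R, fun x hx => ⟨?_, ?_, ?_⟩⟩,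
    by simp, by simp, fun x hx => ?_, fun x hx => ?_, hb1', hb1, hb2⟩
  · refine (((hd x).arctan).const_mul R).congr_deriv ?_
    field_simp
  · have := (((hd x).pow 2).const_add 1).inv (h1 (x / R)).ne'
    simp only [one_div]
    refine this.congr_deriv ?_
    simp
  · refine Continuous.div (by fun_prop) (by fun_prop) fun x => (pow_pos (h1 _) 2).ne'
  · rw [abs_mul, abs_of_pos hR]
    have h2 : |Real.arctan (x / R)| ≤ Real.pi / 2 :=
      abs_le.2 ⟨(Real.neg_pi_div_two_lt_arctan _).le, (Real.arctan_lt_pi_div_two _).le⟩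
    have h3 := mul_le_mul_of_nonneg_left h2 hR.le
    have h4 : 0 < 1 / R := one_div_pos.2 hR
    linarith
  · rw [abs_of_nonneg (hb1' x)]
    have h4 : 0 < 1 / R := one_div_pos.2 hR
    have h5 : 0 < R * (Real.pi / 2) := by positivity
    linarith [hb1 x]
  · have h5 : 0 < R * (Real.pi / 2) := by positivity
    linarith [hb2 x]
  · exact mul_nonneg hR.le (Real.arctan_nonneg.2 (div_nonneg hx hR.le))
  · have h6 := mul_le_mul_of_nonneg_left (Real.arctan_le_self_of_nonneg (div_nonneg hx hR.le)) hR.le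
    rwa [mul_div_cancel₀ _ hR.ne'] at h6

theorem tendsto_integral_one_sub_cutoff {g : ℝ → ℝ} (hg : Integrable g halfLine) :
    Tendsto (fun n : ℕ => ∫ x, (1 - 1 / (1 + (x / ((n : ℝ) + 1)) ^ 2)) * g x ∂halfLine) atTop
      (𝓝 0) := by
  have h := tendsto_integral_of_dominated_convergence (μ := halfLine) (f := fun _ => (0 : ℝ))
    (F := fun (n : ℕ) x => (1 - 1 / (1 + (x / ((n : ℝ) + 1)) ^ 2)) * g x) (fun x => |g x|)
    (fun n => by
      refine AEStronglyMeasurable.mul (Continuous.aestronglyMeasurable ?_) hg.1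
      have := (isCutoff_arctan (R := (n : ℝ) + 1) (by positivity)).continuous_deriv
      exact continuous_const.sub this) hg.abs
    (fun n => Eventually.of_forall fun x => by
      have hc := isCutoff_arctan (R := (n : ℝ) + 1) (by positivity)
      have h1 := hc.deriv_nonneg x
      have h2 := hc.deriv_le_one x
      rw [Real.norm_eq_abs, abs_mul]
      refine mul_le_of_le_one_left (abs_nonneg _) (abs_le.2 ⟨?_, ?_⟩) <;> linarith)
    (Eventually.of_forall fun x => by
      have h1 : Tendsto (fun n : ℕ => x / ((n : ℝ) + 1)) atTop (𝓝 0) := by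
        have := tendsto_one_div_add_atTop_nhds_zero_nat (𝕜 := ℝ)
        simpa [div_eq_mul_inv] using this.const_mul x
      have h2 : Tendsto (fun n : ℕ => 1 + (x / ((n : ℝ) + 1)) ^ 2) atTop (𝓝 1) := by
        simpa using (h1.pow 2).const_add 1
      have h3 : Tendsto (fun n : ℕ => 1 - 1 / (1 + (x / ((n : ℝ) + 1)) ^ 2)) atTop (𝓝 0) := by
        simpa using (h2.inv₀ one_ne_zero).const_sub 1
      simpa using h3.mul_const (g x))
  simpa using h

namespace IsRegularSolution

variable {q p r : ℝ → ℝ → ℂ} {b : ℝ → ℂ} {U P R V : ℝ → HalfLineL2}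
  (H : IsRegularSolution q p r b U P R V)
include H

/-- Dominated convergence in `x` for each time, then in `t` over the fixed interval with the uniform
mass and energy bounds. -/
theorem tendsto_truncation_error {C : ℝ} (hC : 0 ≤ C)
    (hm : ∀ t, 0 ≤ t → ∫ x, ‖q t x‖ ^ 2 ∂halfLine ≤ C)
    (hk : ∀ t, 0 ≤ t → ∫ x, (‖p t x‖ ^ 2 + ‖q t x‖ ^ 4) ∂halfLine ≤ C) {T : ℝ} (hT : 0 ≤ T) :
    Tendsto (fun n : ℕ => ∫ t in (0 : ℝ)..T,
      ((∫ x, (1 - 1 / (1 + (x / ((n : ℝ) + 1)) ^ 2)) * ‖p t x‖ ^ 2 ∂halfLine) +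
        2 * C * ∫ x, (1 - 1 / (1 + (x / ((n : ℝ) + 1)) ^ 2)) * ‖q t x‖ ^ 2 ∂halfLine))
      atTop (𝓝 0) := by
  have hcut : ∀ n : ℕ, IsCutoff _ _ _ _ := fun n =>
    isCutoff_arctan (R := (n : ℝ) + 1) (by positivity)
  have cθ : ∀ n : ℕ, Continuous fun x => 1 - 1 / (1 + (x / ((n : ℝ) + 1)) ^ 2) := fun n =>
    continuous_const.sub (hcut n).continuous_deriv
  have b0 : ∀ (n : ℕ) x, 0 ≤ 1 - 1 / (1 + (x / ((n : ℝ) + 1)) ^ 2) := fun n x =>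
    sub_nonneg.2 ((hcut n).deriv_le_one x)
  have b1 : ∀ (n : ℕ) x, 1 - 1 / (1 + (x / ((n : ℝ) + 1)) ^ 2) ≤ 1 := fun n x =>
    sub_le_self _ ((hcut n).deriv_nonneg x)
  have bθ : ∀ (n : ℕ) x, 0 ≤ x → |1 - 1 / (1 + (x / ((n : ℝ) + 1)) ^ 2)| ≤ 1 := fun n x _ => by
    rw [abs_of_nonneg (b0 n x)]
    exact b1 n x
  have hle : ∀ (n : ℕ) (g : ℝ → ℝ), Integrable g halfLine → (∀ x, 0 ≤ g x) →
      0 ≤ ∫ x, (1 - 1 / (1 + (x / ((n : ℝ) + 1)) ^ 2)) * g x ∂halfLine ∧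
      ∫ x, (1 - 1 / (1 + (x / ((n : ℝ) + 1)) ^ 2)) * g x ∂halfLine ≤ ∫ x, g x ∂halfLine := by
    intro n g hg hg0
    exact ⟨integral_nonneg fun x => mul_nonneg (b0 n x) (hg0 x),
      integral_mono (hg.continuous_mul_halfLine (cθ n) (bθ n)) hg
        fun x => mul_le_of_le_one_left (hg0 x) (b1 n x)⟩
  have h := intervalIntegral.tendsto_integral_filter_of_dominated_convergence
    (μ := volume) (a := 0) (b := T) (l := atTop) (f := fun _ => (0 : ℝ))
    (F := fun (n : ℕ) t =>
      (∫ x, (1 - 1 / (1 + (x / ((n : ℝ) + 1)) ^ 2)) * ‖p t x‖ ^ 2 ∂halfLine) +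
        2 * C * ∫ x, (1 - 1 / (1 + (x / ((n : ℝ) + 1)) ^ 2)) * ‖q t x‖ ^ 2 ∂halfLine)
    (fun _ => C + 2 * C * C)
    (Eventually.of_forall fun n => by
      have hc := (continuousOn_integral_mul_norm_sq H.continuousOn_P H.ae_eq_P (cθ n) (bθ n)).add
        (continuousOn_const (c := 2 * C) |>.mul
          (continuousOn_integral_mul_norm_sq H.continuousOn_U H.ae_eq_U (cθ n) (bθ n)))
      rw [uIoc_of_le hT]
      exact (hc.mono fun t ht => le_of_lt ht.1).aestronglyMeasurable measurableSet_Ioc)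
    (Eventually.of_forall fun n => Eventually.of_forall fun t ht => by
      rw [uIoc_of_le hT] at ht
      have ht0 : 0 ≤ t := ht.1.le
      obtain ⟨p0, p1⟩ := hle n _ (H.isH1_p ht0).memLp.integrable_norm_sq fun x => by positivity
      obtain ⟨q0, q1⟩ := hle n _ (H.isH1_q ht0).memLp.integrable_norm_sq fun x => by positivity
      rw [Real.norm_eq_abs, abs_of_nonneg (by positivity)]
      exact add_le_add (p1.trans ((H.integral_p_sq_le ht0).trans (hk t ht0)))
        (mul_le_mul_of_nonneg_left (q1.trans (hm t ht0)) (by positivity)))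
    intervalIntegrable_const
    (Eventually.of_forall fun t ht => by
      rw [uIoc_of_le hT] at ht
      have ht0 : 0 ≤ t := ht.1.le
      simpa using (tendsto_integral_one_sub_cutoff
        (H.isH1_p ht0).memLp.integrable_norm_sq).add ((tendsto_integral_one_sub_cutoff
        (H.isH1_q ht0).memLp.integrable_norm_sq).const_mul (2 * C)))
  simpa using h

/-- Since `0 ≤ a x ≤ x`, the finite variance of the initial data gives a bound independent of the
truncation. -/
theorem pseudoconformal_zero_le {a a₁ a₂ : ℝ → ℝ} {ε : ℝ} (ha : IsCutoff a a₁ a₂ ε)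
    (hx : Integrable (fun x => x ^ 2 * ‖q 0 x‖ ^ 2) halfLine) :
    pseudoconformal a q p 0 ≤ 3 * (∫ x, x ^ 2 * ‖q 0 x‖ ^ 2 ∂halfLine) +
      6 * ∫ x, (‖p 0 x‖ ^ 2 + ‖q 0 x‖ ^ 4) ∂halfLine := by
  rw [H.pseudoconformal_eq_integral le_rfl ha.toIsWeight, ← integral_const_mul,
    ← integral_const_mul, ← integral_add (hx.const_mul 3)
      ((H.integrable_energy le_rfl).const_mul 6)]
  refine integral_mono_ae (H.integrable_pseudoconformal_density le_rfl ha.toIsWeight _)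
    ((hx.const_mul 3).add ((H.integrable_energy le_rfl).const_mul 6)) ?_
  refine (ae_restrict_iff' measurableSet_Ioi).2 (Eventually.of_forall fun x hx => ?_)
  have hx0 : 0 ≤ x := le_of_lt hx
  have h1 := ha.nonneg x hx0
  have h2 := ha.le_self x hx0
  have h3 := (abs_le.1 (abs_im_conj_mul_le (q 0 x) (p 0 x))).1
  have h4 := mul_le_mul_of_nonneg_left h3 h1
  have h5 : a x ^ 2 ≤ x ^ 2 := pow_le_pow_left₀ h1 h2 2
  have h6 := mul_le_mul_of_nonneg_right h5 (sq_nonneg ‖q 0 x‖)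
  have h7 : 0 ≤ ‖q 0 x‖ ^ 4 := by positivity
  simp only
  nlinarith [sq_nonneg (a x * ‖q 0 x‖ - ‖p 0 x‖)]

/-- With `J = a q + 2i(1 + T) p` and `a` real, `Im(q̄ J) = 2(1 + T) Re(q̄ p)`. This gains the factor
`1/(1 + T)` over the plain estimate, and `‖J‖²` is part of the functional. -/
theorem norm_q_sq_le_pseudoconformal {a a₁ a₂ : ℝ → ℝ} (ha : IsWeight a a₁ a₂) {T : ℝ}
    (hT : 0 ≤ T) {x : ℝ} (hx : 0 ≤ x) :
    ‖q T x‖ ^ 2 ≤ 1 / (1 + T) *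
      (√(∫ y, ‖q T y‖ ^ 2 ∂halfLine) * √(pseudoconformal a q p T)) := by
  have hs : 0 < 1 + T := by linarith
  set J : ℝ → ℂ := fun y => (a y : ℂ) * q T y + 2 * Complex.I * ((1 + T : ℝ) : ℂ) * p T y with hJ
  have mJ : MemLp J 2 halfLine :=
    (ha.memLp_mul (H.isH1_q hT).memLp).add ((H.isH1_p hT).memLp.const_mul _)
  have h1 := (H.isH1_q hT).norm_sq_le_integral hx
  have h2 : ∫ y, |(conj (q T y) * p T y).re| ∂halfLine ≤
      1 / (2 * (1 + T)) * ∫ y, ‖q T y‖ * ‖J y‖ ∂halfLine := by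
    rw [← integral_const_mul]
    refine integral_mono (H.integrable_re hT).abs
      (((H.isH1_q hT).memLp.integrable_norm_mul_norm mJ).const_mul _) fun y => ?_
    have e : (conj (q T y) * J y).im = 2 * (1 + T) * (conj (q T y) * p T y).re := by
      simp [hJ]
      ring
    have h3 := abs_im_conj_mul_le (q T y) (J y)
    rw [e, abs_mul, abs_of_pos (by positivity : 0 < 2 * (1 + T))] at h3
    simp only
    rw [one_div, inv_mul_eq_div, le_div_iff₀ (by positivity)]
    linarith
  have h3 := integral_norm_mul_norm_le (H.isH1_q hT).memLp mJ
  have h4 : ∫ y, ‖J y‖ ^ 2 ∂halfLine ≤ pseudoconformal a q p T := by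
    rw [H.pseudoconformal_eq_integral hT ha]
    refine integral_mono mJ.integrable_norm_sq (H.integrable_pseudoconformal_density hT ha _)
      fun y => ?_
    have h7 : 0 ≤ ‖q T y‖ ^ 4 := by positivity
    have e : ‖J y‖ ^ 2 = a y ^ 2 * ‖q T y‖ ^ 2 -
        4 * (1 + T) * (a y * (conj (q T y) * p T y).im) + 4 * (1 + T) ^ 2 * ‖p T y‖ ^ 2 := by
      simp only [hJ, Complex.sq_norm, Complex.normSq_apply]
      simp
      ring
    simp only
    rw [e]
    nlinarith [mul_nonneg (sq_nonneg (1 + T)) h7]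
  have h5 : √(∫ y, ‖q T y‖ ^ 2 ∂halfLine) * √(∫ y, ‖J y‖ ^ 2 ∂halfLine) ≤
      √(∫ y, ‖q T y‖ ^ 2 ∂halfLine) * √(pseudoconformal a q p T) :=
    mul_le_mul_of_nonneg_left (Real.sqrt_le_sqrt h4) (Real.sqrt_nonneg _)
  have h6 := mul_le_mul_of_nonneg_left (h3.trans h5) (by positivity : 0 ≤ 1 / (1 + T))
  have h7 : 2 * (1 / (2 * (1 + T)) * ∫ y, ‖q T y‖ * ‖J y‖ ∂halfLine) =
      1 / (1 + T) * ∫ y, ‖q T y‖ * ‖J y‖ ∂halfLine := by field_simp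
  linarith

/-- Solutions with square-integrable boundary values and finite variance decay like `t^(-1/4)`,
uniformly in space. -/
theorem exists_norm_sq_le (hx : Integrable (fun x => x ^ 2 * ‖q 0 x‖ ^ 2) halfLine)
    (h2 : IntegrableOn (fun t => ‖q t 0‖ ^ 2) (Ioi 0))
    (h4 : IntegrableOn (fun t => ‖q t 0‖ ^ 4) (Ioi 0))
    (hb : IntegrableOn (fun t => ((1 + t) * ‖b t‖) ^ 2) (Ioi 0)) :
    ∃ K, ∀ T x, 0 ≤ T → 0 ≤ x → ‖q T x‖ ^ 2 ≤ K / √(1 + T) := by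
  have hb' : IntegrableOn (fun t => ‖b t‖ ^ 2) (Ioi 0) := by
    refine Integrable.mono' hb ?_ ?_
    · exact ((H.continuousOn_b.norm.pow 2).mono Ioi_subset_Ici_self).aestronglyMeasurable
        measurableSet_Ioi
    · refine (ae_restrict_iff' measurableSet_Ioi).2 (Eventually.of_forall fun t ht => ?_)
      have ht0 : (0 : ℝ) < t := ht
      rw [Real.norm_of_nonneg (by positivity), mul_pow]
      exact le_mul_of_one_le_left (by positivity) (by nlinarith)
  obtain ⟨C, hC, hbd⟩ := H.exists_bound h2 h4 hb'
  have hm := fun t ht => (hbd t ht).1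
  have hk := fun t ht => (hbd t ht).2.1
  have hg := fun t ht => (hbd t ht).2.2
  set S2 := ∫ t in Ioi (0 : ℝ), ‖q t 0‖ ^ 2
  set Sb := ∫ t in Ioi (0 : ℝ), ((1 + t) * ‖b t‖) ^ 2
  set X := ∫ x, x ^ 2 * ‖q 0 x‖ ^ 2 ∂halfLine
  -- The two final 4's cover the truncation error and `4 (C T)/(n + 1)`, each factor being made less
  -- than 1 below.
  set D := 3 * X + 6 * C + 2 * S2 + 4 * Sb + 6 * C + 4 + 4 with hD
  refine ⟨√C * √D, fun T x hT hx0 => ?_⟩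
  have hs : 0 < 1 + T := by linarith
  have t1 := (H.tendsto_truncation_error hC hm hk hT).eventually (gt_mem_nhds one_pos)
  have t2 : Tendsto (fun n : ℕ => 1 / ((n : ℝ) + 1) * (C * T)) atTop (𝓝 0) := by
    simpa using (tendsto_one_div_add_atTop_nhds_zero_nat (𝕜 := ℝ)).mul_const (C * T)
  -- The truncation index may depend on `T`, because the resulting bound no longer involves the
  -- weight.
  obtain ⟨n, n1, n2⟩ := (t1.and (t2.eventually (gt_mem_nhds one_pos))).exists
  have ha := isCutoff_arctan (R := (n : ℝ) + 1) (by positivity)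
  have e1 := H.pseudoconformal_le ha (by positivity) hm hk hg h2 hb hT
  have e2 := H.pseudoconformal_zero_le ha hx
  have e3 : pseudoconformal (fun x => ((n : ℝ) + 1) * Real.arctan (x / ((n : ℝ) + 1))) q p T ≤
      (1 + T) * D := by
    refine e1.trans (mul_le_mul_of_nonneg_left ?_ hs.le)
    have := hk 0 le_rfl
    rw [hD]
    linarith
  refine (H.norm_q_sq_le_pseudoconformal ha.toIsWeight hT hx0).trans ?_
  have e4 := mul_le_mul (Real.sqrt_le_sqrt (hm T hT)) (Real.sqrt_le_sqrt e3) (Real.sqrt_nonneg _)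
    (Real.sqrt_nonneg _)
  rw [Real.sqrt_mul hs.le] at e4
  have e5 := mul_le_mul_of_nonneg_left e4 (by positivity : 0 ≤ 1 / (1 + T))
  refine e5.trans (le_of_eq ?_)
  have e6 : √(1 + T) * √(1 + T) = 1 + T := Real.mul_self_sqrt hs.le
  have e7 : 0 < √(1 + T) := Real.sqrt_pos.2 hs
  rw [eq_div_iff e7.ne', one_div, inv_mul_eq_div, div_mul_eq_mul_div, div_eq_iff hs.ne']
  linear_combination (√C * √D) * e6

end IsRegularSolution

/-! ### Decay of the boundary data and conclusion -/

theorem ContinuousOn.integrableOn_pow_of_isBigO {f : ℝ → ℝ} {c : ℝ} (n : ℕ)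
    (hf : ContinuousOn f (Ici 0)) (ho : f =O[atTop] fun t : ℝ => t ^ c) (hc : c * n < -1) :
    IntegrableOn (fun t => f t ^ n) (Ioi 0) := by
  have h1 : (fun t => f t ^ n) =O[atTop] fun t : ℝ => t ^ (c * n) := by
    refine (ho.pow n).congr' Filter.EventuallyEq.rfl ?_
    filter_upwards [eventually_gt_atTop 0] with t ht
    rw [Real.rpow_mul_natCast ht.le]
  have h2 : IntegrableOn (fun t => f t ^ n) (Ici 0) :=
    ((hf.pow n).locallyIntegrableOn measurableSet_Ici).integrableOn_of_isBigO_atTop h1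
      (integrableAtFilter_rpow_atTop_iff.2 hc)
  exact h2.mono_set Ioi_subset_Ici_self

theorem theorem3 (q₀ Q : ℝ → ℂ) (q : ℝ → ℝ → ℂ)
    (hQ : ContDiffOn ℝ 2 Q (Ici 0)) (hcompat : Q 0 = q₀ 0)
    (hq : IsGlobalNLSSolution q₀ Q q)
    (hxq₀ : MemLp (fun x : ℝ => (x : ℂ) * q₀ x) 2 halfLine)
    (α β : ℝ) (hα : 3 / 2 < α) (hβ : 5 / 2 < β)
    (hdecay : (fun t : ℝ => q 0 t) =O[atTop] fun t : ℝ => t ^ (-α))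
    (hdecay_deriv : deriv (fun t : ℝ => q 0 t) =O[atTop] fun t : ℝ => t ^ (-β)) :
    (∀ x : ℝ, 0 < x → Tendsto (fun t : ℝ => q x t) atTop (𝓝 0)) ∧
      TendstoUniformlyOn (fun (t : ℝ) (x : ℝ) => q x t) (fun _ => 0) atTop (Ioi 0) := by
  obtain ⟨u, hu⟩ := hq
  obtain ⟨p, r, U, P, R, V, H⟩ := hu.exists_isRegularSolution hQ
  have hx : Integrable (fun x => x ^ 2 * ‖q x 0‖ ^ 2) halfLine := by
    refine hxq₀.integrable_norm_sq.congr ((ae_restrict_iff' measurableSet_Ioi).2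
      (Eventually.of_forall fun x hx => ?_))
    simp only [norm_mul, Complex.norm_real, Real.norm_eq_abs, mul_pow, sq_abs,
      hu.initial x (le_of_lt hx)]
  have hA : (fun t : ℝ => ‖q 0 t‖) =O[atTop] fun t : ℝ => t ^ (-α) := hdecay.norm_left
  have hb : (fun t : ℝ => (1 + t) * ‖derivWithin Q (Ici 0) t‖) =O[atTop]
      fun t : ℝ => t ^ (1 - β) := by
    have h1 : (fun t : ℝ => 1 + t) =O[atTop] fun t : ℝ => t :=
      (isLittleO_const_id_atTop 1).isBigO.add (isBigO_refl _ _)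
    -- For `t > 0` the one-sided derivative of `Q` is the ordinary derivative of `q(0, ·)`, the two
    -- functions agreeing near `t`.
    have h2 : (derivWithin Q (Ici 0)) =O[atTop] fun t : ℝ => t ^ (-β) := by
      refine hdecay_deriv.congr' ?_ Filter.EventuallyEq.rfl
      filter_upwards [eventually_gt_atTop 0] with t ht
      rw [derivWithin_of_mem_nhds (Ici_mem_nhds ht)]
      refine Filter.EventuallyEq.deriv_eq ?_
      filter_upwards [Ici_mem_nhds ht] with s hs using hu.boundary s hs
    refine (h1.mul h2.norm_left).congr' Filter.EventuallyEq.rfl ?_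
    filter_upwards [eventually_gt_atTop 0] with t ht
    rw [sub_eq_add_neg, Real.rpow_add ht, Real.rpow_one]
  -- The exponents to compare with `-1` are `-2α`, `-4α` and `2(1 - β)`.
  obtain ⟨K, hK⟩ := H.exists_norm_sq_le hx
    (H.continuousOn_q_zero.norm.integrableOn_pow_of_isBigO 2 hA (by push_cast; linarith))
    (H.continuousOn_q_zero.norm.integrableOn_pow_of_isBigO 4 hA (by push_cast; linarith))
    (((continuousOn_const.add continuousOn_id).mul
      H.continuousOn_b.norm).integrableOn_pow_of_isBigO 2 hb (by push_cast; linarith))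
  have hlim : Tendsto (fun t : ℝ => √(K / √(1 + t))) atTop (𝓝 0) := by
    have h1 : Tendsto (fun t : ℝ => √(1 + t)) atTop atTop :=
      Real.tendsto_sqrt_atTop.comp (tendsto_atTop_add_const_left _ _ tendsto_id)
    simpa using (h1.const_div_atTop K).sqrt
  have hunif : TendstoUniformlyOn (fun (t : ℝ) (x : ℝ) => q x t) (fun _ => 0) atTop (Ioi 0) := by
    rw [Metric.tendstoUniformlyOn_iff]
    intro ε hε
    filter_upwards [eventually_ge_atTop 0, hlim.eventually (gt_mem_nhds hε)] with t ht hlt x hx0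
    rw [dist_zero_left]
    exact (Real.le_sqrt_of_sq_le (hK t x ht (le_of_lt hx0))).trans_lt hlt
  exact ⟨fun x hx0 => hunif.tendsto_at hx0, hunif⟩
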